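/- Let $n\ge 1$, $n'\ge 0$, $r\ge 1$ be integers and let $A$ be a nonempty countable set. For each $\alpha\in A$ let $\iota_1(\alpha),\dots,\iota_r(\alpha)$ be positive integers and let $(c_{i,j}(\alpha))_{1\le i\le r,\,1\le j\le n}$ be a matrix with entries in $\{0,1,2\}$ such that $\sum_j c_{i,j}(\alpha)=2$ for every $i$ and $\sum_i c_{i,j}(\alpha)>0$ for every $j$. Put $$\varphi_\alpha(z)=\int_{\Delta_\alpha}\ \prod_{j=1}^n\sinh(b_jz)\ \prod_{k=1}^{n'}\frac{\sinh(x_k'z)^2}{x_k'}\ dx_1\cdots dx_r\,dx_1'\cdots dx_{n'}',\qquad b_j=\sum_{i=1}^r c_{i,j}(\alpha)x_i,$$ where $\Delta_\alpha=\{(x,x')\in\mathbb R_{\ge0}^{r+n'}:\ \sum_i\iota_i(\alpha)x_i+\sum_k x_k'\le 1\}$. Let $\mathcal B_r$ be the transform $\sum_{i\ge 0} a_iz^i\mapsto\sum_{i\ge 0}(i+r)!\,a_iz^i$ of power series, and let $$\breve\varphi(z)=\sum_{\alpha\in A}(\mathcal B_r\varphi_\alpha)(z),\qquad \phi(z)=\sum_{\alpha\in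 A}\ \sum_{\epsilon\in\{-1,1\}^n}\epsilon_1\cdots\epsilon_n\prod_{i=1}^r\frac1{\iota_i(\alpha)-(\epsilon_1c_{i,1}(\alpha)+\cdots+\epsilon_nc_{i,n}(\alpha))z}.$$ Let $\iota_0=\min\{\iota_i(\alpha):\alpha\in A,\ 1\le i\le r\}$ and $\mu_0=\max_{\alpha\in A}|\{i:\iota_i(\alpha)=\iota_0\}|$. Assume that $$\sum_{\alpha\in A}\frac1{\iota_1(\alpha)\cdots\iota_r(\alpha)}<\infty .$$ Then every $\varphi_\alpha$ is entire; for $|z|<1/2$ the power series $\mathcal B_r\varphi_\alpha$ and the series defining $\breve\varphi(z)$ converge, and $\breve\varphi$ is holomorphic on $\{|z|<1/2\}$; the series over $A$ defining $\phi(z)$ converges absolutely for every $z\in\mathbb C\smallsetminus\{\pm\iota_i(\alpha)/2\}$; and there is a function $\tilde\phi$, holomorphic near $\iota_0/2$, with $\tilde\phi(\iota_0/2)\neq0$ and $$\phi(z)=\frac{\tilde\phi(z)}{(1-2z/\iota_0)^{\mu_0}}\qquad\text{for } z\ne\iota_0/2 \text{ near } \iota_0/2 .$$ Write $[z^N]\,\breve\varphi(z)$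 for the $N$-th Taylor coefficient of $\breve\varphi$ at $0$, and $a_N\sim b_N$ for $a_N-b_N=o(b_N)$ (so that $a_N=0$ for all large $N$ with $b_N=0$). As $N\to\infty$: * if $n'=0$, then $$[z^N]\,\breve\varphi(z)\sim(1+(-1)^{n+N})\,\tilde\phi(\iota_0/2)\,2^{-n}\left(\frac2{\iota_0}\right)^N\frac{N^{\mu_0-1}}{(\mu_0-1)!};$$ * if $n'>0$ and $\iota_0>1$, then $$[z^N]\,\breve\varphi(z)\sim(1+(-1)^{n+N})\,\phi(1/2)\,2^{N-n-2n'}\,\frac{n'(\log N)^{n'-1}}{N};$$ * if $n'>0$ and $\iota_0=1$, then $$[z^N]\,\breve\varphi(z)\sim(1+(-1)^{n+N})\,\tilde\phi(1/2)\,2^{N-n-2n'}\,\frac{N^{\mu_0-1}}{(\mu_0-1)!}(\log N)^{n'}.$$ -/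

import Mathlib

open Filter Topology MeasureTheory

noncomputable section

namespace ArcAsymptotics

/-- The data attached to a single index `α`: positive integers `ι₁, …, ι_r` and an
`r × n` matrix with entries in `{0, 1, 2}`, all row sums equal to `2`, all column sums positive. -/
structure ArcDatum (n r : ℕ) where
  ι : Fin r → ℕ
  c : Fin r → Fin n → ℕ
  ι_pos : ∀ i, 1 ≤ ι i
  c_le_two : ∀ i j, c i j ≤ 2
  row_sum : ∀ i, ∑ j, c i j = 2
  col_sum_pos : ∀ j, 0 < ∑ i, c i j

/-- The simplex `{(x, x') ≥ 0 : ∑ ι_i x_i + ∑ x'_k ≤ 1}` in `ℝ^r × ℝ^{n'}`. -/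
def simplex {n r : ℕ} (n' : ℕ) (a : ArcDatum n r) : Set ((Fin r → ℝ) × (Fin n' → ℝ)) :=
  {p | (∀ i, 0 ≤ p.1 i) ∧ (∀ k, 0 ≤ p.2 k) ∧
    ∑ i, (a.ι i : ℝ) * p.1 i + ∑ k, p.2 k ≤ 1}

/-- `b_j = ∑ i, c_{i,j} x_i`. -/
def bdry {n r : ℕ} (a : ArcDatum n r) (x : Fin r → ℝ) (j : Fin n) : ℝ :=
  ∑ i, (a.c i j : ℝ) * x i

/-- The generating function `φ_α`, the integral over the simplex of
`∏_j sinh (b_j z) · ∏_k sinh (x'_k z)² / x'_k`. -/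
def varphi {n r : ℕ} (n' : ℕ) (a : ArcDatum n r) (z : ℂ) : ℂ :=
  ∫ p in simplex n' a,
    (∏ j, Complex.sinh ((bdry a p.1 j : ℂ) * z)) *
      ∏ k, Complex.sinh ((p.2 k : ℂ) * z) ^ 2 / (p.2 k : ℂ)

/-- The Taylor coefficient `[z^N] f` at the origin. -/
def taylorCoeff (f : ℂ → ℂ) (N : ℕ) : ℂ :=
  iteratedDeriv N f 0 / (N.factorial : ℂ)

/-- The transform `∑ a_i z^i ↦ ∑ (i + d)! a_i z^i` on formal power series. -/
def borel (d : ℕ) (p : PowerSeries ℂ) : PowerSeries ℂ :=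
  PowerSeries.mk fun i => ((i + d).factorial : ℂ) * PowerSeries.coeff i p

/-- The power series `B_r φ_α`, where `φ_α` is identified with its Taylor series at `0`. -/
def brevePS {n r : ℕ} (n' : ℕ) (a : ArcDatum n r) : PowerSeries ℂ :=
  borel r (PowerSeries.mk (taylorCoeff (varphi n' a)))

/-- The sum of the power series `B_r φ_α` at `z`. -/
def breveTerm {n r : ℕ} (n' : ℕ) (a : ArcDatum n r) (z : ℂ) : ℂ :=
  ∑' N, PowerSeries.coeff N (brevePS n' a) * z ^ N

/-- The sum over the family of the functions `B_r φ_α`. -/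
def breve {A : Type*} {n r : ℕ} (n' : ℕ) (D : A → ArcDatum n r) (z : ℂ) : ℂ :=
  ∑' α, breveTerm n' (D α) z

/-- The rational function
`∑_{ε ∈ {-1,1}^n} ε_1 ⋯ ε_n ∏_i 1 / (ι_i - (∑_j ε_j c_{i,j}) z)`. -/
def phiTerm {n r : ℕ} (a : ArcDatum n r) (z : ℂ) : ℂ :=
  ∑ ε : Fin n → ℤˣ, (∏ j, ((ε j : ℤ) : ℂ)) *
    ∏ i, 1 / ((a.ι i : ℂ) - (∑ j, ((ε j : ℤ) : ℂ) * (a.c i j : ℂ)) * z)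

/-- The sum over the family of the rational functions `phiTerm`. -/
def phi {A : Type*} {n r : ℕ} (D : A → ArcDatum n r) (z : ℂ) : ℂ :=
  ∑' α, phiTerm (D α) z

/-- `ι₀`, the smallest of all the integers `ι_i(α)`. -/
def iotaMin {A : Type*} {n r : ℕ} (D : A → ArcDatum n r) : ℕ :=
  sInf {m | ∃ α i, (D α).ι i = m}

/-- `μ₀`, the maximum over `α` of the number of indices `i` with `ι_i(α) = ι₀`. -/
def muMax {A : Type*} {n r : ℕ} (D : A → ArcDatum n r) : ℕ :=
  sSup {m | ∃ α, (Finset.univ.filter fun i => (D α).ι i = iotaMin D).card = m}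

end ArcAsymptotics

end

noncomputable section

namespace ArcAsymptotics

/-- `f` is the sum of the power series with coefficients `c` on the open disc of radius `R`. -/
def HasPS (R : ℝ) (f : ℂ → ℂ) (c : ℕ → ℂ) : Prop :=
  ∀ z : ℂ, ‖z‖ < R → HasSum (fun N => c N * z ^ N) (f z)

namespace HasPS

variable {R : ℝ} {f g : ℂ → ℂ} {c d : ℕ → ℂ}

lemma congr (h : HasPS R f c) (hfg : ∀ z, ‖z‖ < R → g z = f z) : HasPS R g c :=
  fun z hz => by rw [hfg z hz]; exact h z hz

lemma mono {R' : ℝ} (h : HasPS R f c) (hR : R' ≤ R) : HasPS R' f c :=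
  fun z hz => h z (hz.trans_le hR)

lemma summable_norm (h : HasPS R f c) {ρ : ℝ} (h0 : 0 ≤ ρ) (hρ : ρ < R) :
    Summable fun N => ‖c N‖ * ρ ^ N := by
  have := (h (ρ : ℂ) (by simpa [abs_of_nonneg h0] using hρ)).summable.norm
  simpa [abs_of_nonneg h0] using this

lemma summable_norm' (h : HasPS R f c) {z : ℂ} (hz : ‖z‖ < R) :
    Summable fun N => ‖c N * z ^ N‖ := (h z hz).summable.norm

lemma mul (hf : HasPS R f c) (hg : HasPS R g d) :
    HasPS R (fun z => f z * g z)
      (fun N => ∑ kl ∈ Finset.HasAntidiagonal.antidiagonal N, c kl.1 * d kl.2) := by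
  intro z hz
  have h1 := hf.summable_norm' hz
  have h2 := hg.summable_norm' hz
  have h3 : ∀ N, (∑ kl ∈ Finset.HasAntidiagonal.antidiagonal N, c kl.1 * d kl.2) * z ^ N =
      ∑ kl ∈ Finset.HasAntidiagonal.antidiagonal N, (c kl.1 * z ^ kl.1) * (d kl.2 * z ^ kl.2) := by
    intro N
    rw [Finset.sum_mul]
    refine Finset.sum_congr rfl fun kl hkl => ?_
    rw [← Finset.HasAntidiagonal.mem_antidiagonal.1 hkl, pow_add]; ring
  simp only [h3]
  have h4 := (summable_norm_sum_mul_antidiagonal_of_summable_norm h1 h2).of_norm.hasSum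
  rwa [← tsum_mul_tsum_eq_tsum_sum_antidiagonal_of_summable_norm h1 h2,
    (hf z hz).tsum_eq, (hg z hz).tsum_eq] at h4

lemma const_mul (hf : HasPS R f c) (a : ℂ) :
    HasPS R (fun z => a * f z) (fun N => a * c N) := by
  intro z hz
  simpa [mul_assoc] using (hf z hz).mul_left a

lemma scale (hf : HasPS R f c) {a : ℂ} {R' : ℝ} (h : ∀ z : ℂ, ‖z‖ < R' → ‖a * z‖ < R) :
    HasPS R' (fun z => f (a * z)) (fun N => c N * a ^ N) := by
  intro z hz
  simpa [mul_pow, mul_assoc] using hf (a * z) (h z hz)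

lemma comp_sq (hf : HasPS R f c) {R' : ℝ} (h : ∀ z : ℂ, ‖z‖ < R' → ‖z ^ 2‖ < R) :
    HasPS R' (fun z => f (z ^ 2)) (fun N => if Even N then c (N / 2) else 0) := by
  intro z hz
  have h1 := hf (z ^ 2) (h z hz)
  have hinj : Function.Injective fun n : ℕ => 2 * n := fun a b hab => by simpa using hab
  refine (hinj.hasSum_iff (f := fun N => (if Even N then c (N / 2) else 0) * z ^ N) ?_).1 ?_
  · intro N hN
    have : ¬ Even N := by
      rintro ⟨k, rfl⟩
      exact hN ⟨k, by simp [two_mul]⟩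
    simp [this]
  · simpa [Function.comp_def, pow_mul] using h1

lemma hasFPowerSeriesOnBall (h : HasPS R f c) (hR : 0 < R) :
    HasFPowerSeriesOnBall f (FormalMultilinearSeries.ofScalars ℂ c) 0 (ENNReal.ofReal R) where
  r_le := by
    refine ENNReal.le_of_forall_nnreal_lt fun ρ hρ => ?_
    apply FormalMultilinearSeries.le_radius_of_summable
    have hρ' : (ρ : ℝ) < R := by
      have := (ENNReal.lt_ofReal_iff_toReal_lt (by simp)).1 hρ
      simpa using this
    refine (h.summable_norm ρ.2 hρ').congr fun N => ?_
    rw [FormalMultilinearSeries.ofScalars_norm]; rfl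
  r_pos := by simpa using hR
  hasSum := by
    intro y hy
    have hy' : ‖y‖ < R := by
      rw [Metric.eball_ofReal] at hy
      simpa using hy
    simpa [FormalMultilinearSeries.ofScalars_apply_eq, mul_comm] using h y hy'

lemma taylorCoeff_eq (h : HasPS R f c) (hR : 0 < R) (N : ℕ) : taylorCoeff f N = c N := by
  have h1 := (h.hasFPowerSeriesOnBall hR).factorial_smul 1 N
  rw [← iteratedDeriv_eq_iteratedFDeriv] at h1
  rw [taylorCoeff, ← h1, FormalMultilinearSeries.ofScalars_apply_eq]
  have : (N.factorial : ℂ) ≠ 0 := by exact_mod_cast N.factorial_ne_zero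
  field_simp
  simp [mul_comm]

lemma differentiableOn (h : HasPS R f c) : DifferentiableOn ℂ f (Metric.ball 0 R) := by
  rcases le_or_gt R 0 with hR | hR
  · rw [Metric.ball_eq_empty.2 hR]; exact differentiableOn_empty
  · have := (h.hasFPowerSeriesOnBall hR).differentiableOn
    rwa [Metric.eball_ofReal] at this

end HasPS

lemma hasPS_taylorCoeff {R : ℝ} {f : ℂ → ℂ} (h : DifferentiableOn ℂ f (Metric.ball 0 R)) :
    HasPS R f (taylorCoeff f) := by
  intro z hz
  have := Complex.hasSum_taylorSeries_on_ball h (z := z) (by simpa using hz)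
  refine (congrArg (fun u => HasSum u (f z)) (funext fun N => ?_)).mp this
  simp only [taylorCoeff, sub_zero, smul_eq_mul]
  ring

lemma taylorCoeff_congr {R : ℝ} (hR : 0 < R) {f g : ℂ → ℂ}
    (h : ∀ z : ℂ, ‖z‖ < R → f z = g z) (N : ℕ) : taylorCoeff f N = taylorCoeff g N := by
  have : f =ᶠ[𝓝 0] g := by
    filter_upwards [Metric.ball_mem_nhds (0 : ℂ) hR] with z hz
    exact h z (by simpa using hz)
  rw [taylorCoeff, taylorCoeff, this.iteratedDeriv_eq]

/-- Taylor coefficients of a function of parity `n` vanish at the orders of the other parity. -/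
lemma taylorCoeff_eq_zero_of_parity {R : ℝ} (hR : 0 < R) {f : ℂ → ℂ} {n : ℕ}
    (hf : DifferentiableOn ℂ f (Metric.ball 0 R))
    (h : ∀ z : ℂ, ‖z‖ < R → f (-z) = (-1) ^ n * f z) {N : ℕ} (hN : Odd (n + N)) :
    taylorCoeff f N = 0 := by
  have h1 := hasPS_taylorCoeff hf
  have h2 := (h1.scale (a := -1) (R' := R) (by simp)).taylorCoeff_eq hR N
  have h3 := (h1.const_mul ((-1) ^ n)).taylorCoeff_eq hR N
  have h4 := taylorCoeff_congr hR (f := fun z => f (-1 * z)) (g := fun z => (-1) ^ n * f z)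
    (by simpa using h) N
  rw [h2, h3] at h4
  have h5 : (-1 : ℂ) ^ n * (-1) ^ N = -1 := by rw [← pow_add, hN.neg_one_pow]
  have h6 : ((-1 : ℂ) ^ n) * (-1) ^ n = 1 := by rw [← mul_pow]; simp
  have : taylorCoeff f N = - taylorCoeff f N := by
    calc taylorCoeff f N = ((-1) ^ n * (-1) ^ n) * taylorCoeff f N := by rw [h6, one_mul]
      _ = (-1) ^ n * (taylorCoeff f N * (-1) ^ N) := by rw [h4]; ring
      _ = ((-1 : ℂ) ^ n * (-1) ^ N) * taylorCoeff f N := by ring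
      _ = - taylorCoeff f N := by rw [h5]; ring
  exact self_eq_neg.1 this

lemma taylorCoeff_deriv (f : ℂ → ℂ) (N : ℕ) :
    taylorCoeff (deriv f) N = (N + 1) * taylorCoeff f (N + 1) := by
  rw [taylorCoeff, taylorCoeff, iteratedDeriv_succ', Nat.factorial_succ]
  have : (N.factorial : ℂ) ≠ 0 := by exact_mod_cast N.factorial_ne_zero
  have : (N + 1 : ℂ) ≠ 0 := by exact_mod_cast N.succ_ne_zero
  push_cast
  field_simp

end ArcAsymptotics

namespace ArcAsymptotics

/-- The function `(1 - v)^{-μ} (-log (1 - v))^k`. -/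
def logPow (μ k : ℕ) (v : ℂ) : ℂ := (1 / (1 - v)) ^ μ * (-Complex.log (1 - v)) ^ k

/-- The Taylor coefficients of `(1 - v)^{-μ} (-log (1 - v))^k`. -/
def logPowCoeff (μ k N : ℕ) : ℂ := taylorCoeff (logPow μ k) N

lemma one_sub_mem_slitPlane {v : ℂ} (hv : ‖v‖ < 1) : 1 - v ∈ Complex.slitPlane := by
  simpa [sub_eq_add_neg] using Complex.mem_slitPlane_of_norm_lt_one (z := -v) (by simpa using hv)

lemma one_sub_ne_zero {v : ℂ} (hv : ‖v‖ < 1) : 1 - v ≠ 0 :=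
  Complex.slitPlane_ne_zero (one_sub_mem_slitPlane hv)

lemma hasPS_logPow (μ k : ℕ) : HasPS 1 (logPow μ k) (logPowCoeff μ k) := by
  refine hasPS_taylorCoeff fun v hv => DifferentiableAt.differentiableWithinAt ?_
  have hv' : ‖v‖ < 1 := by simpa using hv
  have h1 : DifferentiableAt ℂ (fun v : ℂ => 1 - v) v := by fun_prop
  unfold logPow
  refine DifferentiableAt.mul (DifferentiableAt.pow (DifferentiableAt.div (by fun_prop) h1
    (one_sub_ne_zero hv')) _) (DifferentiableAt.pow (DifferentiableAt.neg ?_) _)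
  exact h1.clog (one_sub_mem_slitPlane hv')

lemma hasPS_geometric : HasPS 1 (fun v => 1 / (1 - v)) (fun _ => 1) := by
  intro z hz
  simpa using hasSum_geometric_of_norm_lt_one hz

lemma logPowCoeff_succ (μ k m : ℕ) :
    logPowCoeff (μ + 1) k m = ∑ j ∈ Finset.range (m + 1), logPowCoeff μ k j := by
  have h := (((hasPS_logPow μ k).mul hasPS_geometric).congr (g := logPow (μ + 1) k)
    fun z _ => by simp only [logPow, pow_succ]; ring).taylorCoeff_eq one_pos m
  rw [logPowCoeff, h]
  simpa using Finset.Nat.sum_antidiagonal_eq_sum_range_succ_mk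
    (fun kl : ℕ × ℕ => logPowCoeff μ k kl.1) m

lemma logPowCoeff_one_zero (m : ℕ) : logPowCoeff 1 0 m = 1 :=
  (hasPS_geometric.congr (g := logPow 1 0) fun z _ => by simp [logPow]).taylorCoeff_eq one_pos m

lemma logPowCoeff_zero_succ (k m : ℕ) :
    (m + 1 : ℂ) * logPowCoeff 0 (k + 1) (m + 1) = (k + 1) * logPowCoeff 1 k m := by
  rw [logPowCoeff, ← taylorCoeff_deriv,
    ← ((hasPS_logPow 1 k).const_mul (k + 1)).taylorCoeff_eq one_pos m]
  refine taylorCoeff_congr one_pos (fun z hz => ?_) m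
  have h1 : HasDerivAt (fun v : ℂ => 1 - v) (-1) z := by
    simpa using (hasDerivAt_id z).const_sub 1
  have h2 := ((h1.clog (one_sub_mem_slitPlane hz)).neg.pow (k + 1)).deriv
  have h3 : logPow 0 (k + 1) = (-fun v : ℂ => Complex.log (1 - v)) ^ (k + 1) := by
    ext v; simp [logPow]
  rw [h3, h2]
  simp [logPow]
  ring

/-- The sequence `m^μ (log m)^k`. -/
def powLog (μ k m : ℕ) : ℝ := (m : ℝ) ^ μ * Real.log m ^ k

lemma powLog_mono (μ k : ℕ) : Monotone (powLog μ k) := by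
  refine monotone_nat_of_le_succ fun m => ?_
  have h : Real.log (m : ℝ) ≤ Real.log ((m + 1 : ℕ) : ℝ) := by
    rcases Nat.eq_zero_or_pos m with rfl | hm
    · simp
    · exact Real.log_le_log (by positivity) (by push_cast; linarith)
  unfold powLog
  have := Real.log_natCast_nonneg m
  have := Real.log_natCast_nonneg (m + 1)
  gcongr
  simp

lemma eventually_log_pos : ∀ᶠ m : ℕ in atTop, 0 < Real.log m := by
  filter_upwards [eventually_ge_atTop 2] with m hm
  exact Real.log_pos (by exact_mod_cast hm)

lemma tendsto_log_natCast : Tendsto (fun m : ℕ => Real.log m) atTop atTop :=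
  Real.tendsto_log_atTop.comp tendsto_natCast_atTop_atTop

lemma tendsto_mul_log_succ_sub :
    Tendsto (fun m : ℕ => (m : ℝ) * (Real.log (m + 1 : ℕ) - Real.log m)) atTop (𝓝 1) := by
  have h := (Real.tendsto_mul_log_one_add_div_atTop 1).comp
    (tendsto_natCast_atTop_atTop (R := ℝ))
  refine h.congr' ?_
  filter_upwards [eventually_gt_atTop 0] with m hm
  have : (0 : ℝ) < m := by exact_mod_cast hm
  simp only [Function.comp]
  rw [← Real.log_div (by positivity) (by positivity)]
  congr 2
  push_cast
  field_simp

lemma tendsto_log_succ_div :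
    Tendsto (fun m : ℕ => Real.log (m + 1 : ℕ) / Real.log m) atTop (𝓝 1) := by
  have h1 : Tendsto (fun m : ℕ => ((m : ℝ) * (Real.log (m + 1 : ℕ) - Real.log m)) *
      ((m : ℝ)⁻¹ * (Real.log m)⁻¹) + 1) atTop (𝓝 (1 * (0 * 0) + 1)) :=
    (tendsto_mul_log_succ_sub.mul (((tendsto_inv_atTop_nhds_zero_nat (𝕜 := ℝ))).mul
      tendsto_log_natCast.inv_tendsto_atTop)).add tendsto_const_nhds
  simp only [mul_zero, zero_add] at h1
  refine h1.congr' ?_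
  filter_upwards [eventually_gt_atTop 0, eventually_log_pos] with m hm hl
  have : (0 : ℝ) < m := by exact_mod_cast hm
  field_simp
  ring

lemma tendsto_succ_div : Tendsto (fun m : ℕ => ((m + 1 : ℕ) : ℝ) / m) atTop (𝓝 1) := by
  have h : Tendsto (fun m : ℕ => 1 + (m : ℝ)⁻¹) atTop (𝓝 (1 + 0)) :=
    tendsto_const_nhds.add tendsto_inv_atTop_nhds_zero_nat
  rw [add_zero] at h
  refine h.congr' ?_
  filter_upwards [eventually_gt_atTop 0] with m hm
  have : (0 : ℝ) < m := by exact_mod_cast hm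
  push_cast
  field_simp

lemma tendsto_powLog_succ_div (μ k : ℕ) :
    Tendsto (fun m : ℕ => powLog μ k (m + 1) / powLog μ k m) atTop (𝓝 1) := by
  have := (tendsto_succ_div.pow μ).mul (tendsto_log_succ_div.pow k)
  simp only [one_pow, mul_one] at this
  refine this.congr fun m => ?_
  rw [powLog, powLog, div_pow, div_pow, div_mul_div_comm]

lemma eventually_powLog_pos (μ k : ℕ) : ∀ᶠ m : ℕ in atTop, 0 < powLog μ k m := by
  filter_upwards [eventually_gt_atTop 0, eventually_log_pos] with m hm hl
  have : (0 : ℝ) < m := by exact_mod_cast hm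
  unfold powLog; positivity

lemma tendsto_powLog {μ k : ℕ} (h : 0 < μ + k) : Tendsto (powLog μ k) atTop atTop := by
  rcases Nat.eq_zero_or_pos μ with rfl | hμ
  · have h1 := (tendsto_pow_atTop (α := ℝ) (n := k) (by omega)).comp tendsto_log_natCast
    refine h1.congr fun m => by simp [powLog]
  · refine tendsto_atTop_mono' _ ?_ (tendsto_natCast_atTop_atTop (R := ℝ))
    filter_upwards [eventually_ge_atTop 1,
      tendsto_log_natCast.eventually_ge_atTop 1] with m hm hl
    have hm' : (1 : ℝ) ≤ m := by exact_mod_cast hm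
    calc (m : ℝ) = m ^ 1 * 1 := by ring
      _ ≤ m ^ μ * Real.log m ^ k :=
        mul_le_mul (pow_le_pow_right₀ hm' hμ) (one_le_pow₀ hl) zero_le_one (by positivity)

/-- If `s_m → 1` and `x_m (s_m - 1) → a` then `x_m (s_m ^ k - 1) → k a`. -/
lemma tendsto_mul_pow_sub_one {x s : ℕ → ℝ} {a : ℝ} (hs : Tendsto s atTop (𝓝 1))
    (hx : Tendsto (fun m => x m * (s m - 1)) atTop (𝓝 a)) (k : ℕ) :
    Tendsto (fun m => x m * (s m ^ k - 1)) atTop (𝓝 (k * a)) := by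
  have h1 : Tendsto (fun m => ∑ i ∈ Finset.range k, s m ^ i) atTop
      (𝓝 (∑ i ∈ Finset.range k, (1 : ℝ) ^ i)) :=
    tendsto_finsetSum _ fun i _ => hs.pow i
  have h2 := h1.mul hx
  simp only [one_pow, Finset.sum_const, Finset.card_range, nsmul_eq_mul, mul_one] at h2
  refine h2.congr fun m => ?_
  rw [← geom_sum_mul]; ring

lemma tendsto_log_step (k : ℕ) : Tendsto (fun m : ℕ => (m : ℝ) * Real.log m *
    ((Real.log (m + 1 : ℕ) / Real.log m) ^ k - 1)) atTop (𝓝 k) := by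
  have h := tendsto_mul_pow_sub_one (x := fun m : ℕ => (m : ℝ) * Real.log m)
    tendsto_log_succ_div (a := 1) (tendsto_mul_log_succ_sub.congr' ?_) k
  · simpa using h
  · filter_upwards [eventually_log_pos] with m hl
    field_simp

lemma tendsto_powLog_step (μ k : ℕ) :
    Tendsto (fun m : ℕ => (powLog (μ + 1) k (m + 1) - powLog (μ + 1) k m) / powLog μ k m)
      atTop (𝓝 (μ + 1)) := by
  have h1 : Tendsto (fun m : ℕ => (m : ℝ) * ((((m + 1 : ℕ) : ℝ) / m) ^ (μ + 1) - 1)) atTop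
      (𝓝 (((μ + 1 : ℕ) : ℝ) * 1)) := by
    refine tendsto_mul_pow_sub_one tendsto_succ_div ?_ _
    refine tendsto_const_nhds.congr' ?_
    filter_upwards [eventually_gt_atTop 0] with m hm
    have : (0 : ℝ) < m := by exact_mod_cast hm
    push_cast; field_simp; ring
  have h2 : Tendsto (fun m : ℕ => (m : ℝ) * Real.log m *
      ((Real.log (m + 1 : ℕ) / Real.log m) ^ k - 1) * (Real.log m)⁻¹) atTop (𝓝 (k * 0)) :=
    (tendsto_log_step k).mul tendsto_log_natCast.inv_tendsto_atTop
  have h3 := (h1.mul (tendsto_log_succ_div.pow k)).add h2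
  simp only [one_pow, mul_one, mul_zero, add_zero, Nat.cast_add, Nat.cast_one] at h3
  refine h3.congr' ?_
  filter_upwards [eventually_gt_atTop 0, eventually_log_pos] with m hm hl
  have : (0 : ℝ) < m := by exact_mod_cast hm
  simp only [powLog, div_pow, pow_succ]
  push_cast
  field_simp
  ring

lemma tendsto_log_pow_step (k : ℕ) :
    Tendsto (fun m : ℕ => (powLog 0 (k + 1) (m + 1) - powLog 0 (k + 1) m) /
      (powLog 0 k m / m)) atTop (𝓝 (k + 1)) := by
  have h := tendsto_log_step (k + 1)
  push_cast at h
  refine h.congr' ?_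
  filter_upwards [eventually_gt_atTop 0, eventually_log_pos] with m hm hl
  have : (0 : ℝ) < m := by exact_mod_cast hm
  simp only [powLog, div_pow, pow_succ]
  push_cast
  field_simp

/-- Summation of asymptotic equivalences, in terms of ratios. -/
lemma tendsto_sum_div {u : ℕ → ℂ} {b : ℕ → ℝ} {a : ℂ} (hb : Monotone b)
    (hb' : Tendsto b atTop atTop)
    (h : (fun m => u m - a * ((b (m + 1) - b m : ℝ) : ℂ)) =o[atTop] fun m => b (m + 1) - b m) :
    Tendsto (fun m => (∑ j ∈ Finset.range m, u j) / (b m : ℂ)) atTop (𝓝 a) := by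
  have hsum : ∀ m, ∑ j ∈ Finset.range m, (b (j + 1) - b j) = b m - b 0 :=
    fun m => Finset.sum_range_sub b m
  have h1 := h.sum_range (fun m => sub_nonneg.2 (hb m.le_succ)) (by
    simp only [hsum]
    exact tendsto_atTop_add_const_right _ _ hb')
  simp only [hsum, Finset.sum_sub_distrib, ← Finset.mul_sum, ← Complex.ofReal_sum] at h1
  have h0 : (fun _ : ℕ => b 0) =o[atTop] b :=
    Asymptotics.isLittleO_const_left.2 (Or.inr (tendsto_norm_atTop_atTop.comp hb'))
  have h2 : (fun m => (∑ j ∈ Finset.range m, u j) - a * ((b m - b 0 : ℝ) : ℂ)) =o[atTop] b :=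
    h1.trans_isBigO ((Asymptotics.isBigO_refl _ _).sub h0.isBigO)
  have h3 : (fun m => (∑ j ∈ Finset.range m, u j) - a * (b m : ℂ)) =o[atTop] b := by
    have h4 : (fun _ : ℕ => a * (b 0 : ℂ)) =o[atTop] b :=
      Asymptotics.isLittleO_const_left.2 (Or.inr (tendsto_norm_atTop_atTop.comp hb'))
    refine (h2.sub h4).congr_left fun m => ?_
    push_cast; ring
  have h5 : (fun m => (∑ j ∈ Finset.range m, u j) - a * (b m : ℂ)) =o[atTop]
      fun m => (b m : ℂ) := h3.trans_isBigO (Asymptotics.IsBigO.of_bound 1 (by simp))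
  have h6 := h5.tendsto_div_nhds_zero.add_const a
  rw [zero_add] at h6
  refine h6.congr' ?_
  filter_upwards [hb'.eventually_gt_atTop 0] with m hm
  have : (b m : ℂ) ≠ 0 := by exact_mod_cast hm.ne'
  field_simp
  ring

lemma tendsto_sum_div' {u : ℕ → ℂ} {b w : ℕ → ℝ} {a d : ℝ} (hd : d ≠ 0) (hb : Monotone b)
    (hb' : Tendsto b atTop atTop) (hw : ∀ᶠ m in atTop, 0 < w m)
    (hbw : Tendsto (fun m => (b (m + 1) - b m) / w m) atTop (𝓝 d))
    (huw : Tendsto (fun m => u m / (w m : ℂ)) atTop (𝓝 (a : ℂ))) :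
    Tendsto (fun m => (∑ j ∈ Finset.range m, u j) / (b m : ℂ)) atTop (𝓝 ((a / d : ℝ) : ℂ)) := by
  refine tendsto_sum_div hb hb' ?_
  have hne : ∀ᶠ m in atTop, b (m + 1) - b m ≠ 0 := by
    filter_upwards [hbw.eventually_ne hd] with m hm h0
    simp [h0] at hm
  have h2 : Tendsto (fun m => u m / ((b (m + 1) - b m : ℝ) : ℂ)) atTop (𝓝 ((a / d : ℝ) : ℂ)) := by
    have hbw' : Tendsto (fun m => (((b (m + 1) - b m) / w m : ℝ) : ℂ)) atTop (𝓝 (d : ℂ)) :=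
      (Complex.continuous_ofReal.tendsto d).comp hbw
    have := huw.div hbw' (by exact_mod_cast hd)
    rw [Complex.ofReal_div]
    refine this.congr' ?_
    filter_upwards [hw] with m hm
    have : (w m : ℂ) ≠ 0 := by exact_mod_cast hm.ne'
    simp only [Pi.div_apply, Complex.ofReal_div]
    rw [div_div_div_cancel_right₀ this]
  have h3 : (fun m => u m - ((a / d : ℝ) : ℂ) * ((b (m + 1) - b m : ℝ) : ℂ)) =o[atTop]
      fun m => ((b (m + 1) - b m : ℝ) : ℂ) := by
    rw [Asymptotics.isLittleO_iff_tendsto']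
    · have := h2.sub_const ((a / d : ℝ) : ℂ)
      rw [sub_self] at this
      refine this.congr' ?_
      filter_upwards [hne] with m hm
      have : ((b (m + 1) - b m : ℝ) : ℂ) ≠ 0 := by exact_mod_cast hm
      field_simp
    · filter_upwards [hne] with m hm h0
      exact absurd (by exact_mod_cast h0) hm
  exact h3.trans_isBigO (Asymptotics.IsBigO.of_bound 1 (Eventually.of_forall fun m => by
    rw [one_mul, Complex.norm_real]))

/-- Shifting the index by one, against a slowly varying sequence. -/
lemma tendsto_shift_div {u : ℕ → ℂ} {b : ℕ → ℝ} {a : ℂ} (hb : ∀ᶠ m in atTop, 0 < b m)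
    (hb' : Tendsto (fun m => b (m + 1) / b m) atTop (𝓝 1))
    (h : Tendsto (fun m => u m / (b m : ℂ)) atTop (𝓝 a)) :
    Tendsto (fun m => u (m + 1) / (b m : ℂ)) atTop (𝓝 a) := by
  have h1 := (h.comp (tendsto_add_atTop_nat 1)).mul
    ((Complex.continuous_ofReal.tendsto 1).comp hb')
  rw [Complex.ofReal_one, mul_one] at h1
  refine h1.congr' ?_
  filter_upwards [hb, (tendsto_add_atTop_nat 1).eventually hb] with m hm hm'
  have h2 : (b m : ℂ) ≠ 0 := by exact_mod_cast hm.ne'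
  have h3 : (b (m + 1) : ℂ) ≠ 0 := by exact_mod_cast hm'.ne'
  simp only [Function.comp, Complex.ofReal_div]
  field_simp

lemma tendsto_logPowCoeff_zero_of {k : ℕ}
    (h : Tendsto (fun m => logPowCoeff 1 k m / (powLog 0 k m : ℂ)) atTop (𝓝 1)) :
    Tendsto (fun m => logPowCoeff 0 (k + 1) m / ((powLog 0 k m / m : ℝ) : ℂ)) atTop
      (𝓝 ((k + 1 : ℝ) : ℂ)) := by
  have h1 : Tendsto (fun m => logPowCoeff 0 (k + 1) (m + 1) / ((powLog 0 k (m + 1) /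
      ((m + 1 : ℕ) : ℝ) : ℝ) : ℂ)) atTop (𝓝 ((k + 1 : ℝ) : ℂ)) := by
    have h2 := (h.const_mul (k + 1 : ℂ)).mul
      ((Complex.continuous_ofReal.tendsto _).comp ((tendsto_powLog_succ_div 0 k).inv₀
        one_ne_zero))
    rw [inv_one, Complex.ofReal_one, mul_one, mul_one] at h2
    push_cast
    refine h2.congr' ?_
    filter_upwards [eventually_powLog_pos 0 k,
      (tendsto_add_atTop_nat 1).eventually (eventually_powLog_pos 0 k)] with m hm hm'
    have h2 : (powLog 0 k m : ℂ) ≠ 0 := by exact_mod_cast hm.ne'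
    have h3 : (powLog 0 k (m + 1) : ℂ) ≠ 0 := by exact_mod_cast hm'.ne'
    have h4 := logPowCoeff_zero_succ k m
    simp only [Function.comp]
    push_cast
    field_simp
    linear_combination -h4
  exact (tendsto_add_atTop_iff_nat (f := fun m => logPowCoeff 0 (k + 1) m /
    ((powLog 0 k m / m : ℝ) : ℂ)) 1).1 h1

lemma tendsto_logPowCoeff_one (k : ℕ) :
    Tendsto (fun m => logPowCoeff 1 k m / (powLog 0 k m : ℂ)) atTop (𝓝 1) := by
  induction k with
  | zero => simp [logPowCoeff_one_zero, powLog]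
  | succ k ih =>
    have h1 := tendsto_logPowCoeff_zero_of ih
    have h2 := tendsto_sum_div' (by positivity) (powLog_mono 0 (k + 1)) (tendsto_powLog (by omega))
      (by
        filter_upwards [eventually_gt_atTop 0, eventually_powLog_pos 0 k] with m hm hl
        have : (0 : ℝ) < m := by exact_mod_cast hm
        positivity) (tendsto_log_pow_step k) h1
    rw [div_self (by positivity), Complex.ofReal_one] at h2
    simp only [logPowCoeff_succ 0 (k + 1)]
    exact tendsto_shift_div (u := fun m => ∑ j ∈ Finset.range m, logPowCoeff 0 (k + 1) j)
      (eventually_powLog_pos _ _) (tendsto_powLog_succ_div _ _) h2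

/-- The coefficients of `(-log (1 - v))^{k+1}`. -/
lemma tendsto_logPowCoeff_zero (k : ℕ) :
    Tendsto (fun m => logPowCoeff 0 (k + 1) m / ((powLog 0 k m / m : ℝ) : ℂ)) atTop
      (𝓝 ((k + 1 : ℝ) : ℂ)) :=
  tendsto_logPowCoeff_zero_of (tendsto_logPowCoeff_one k)

/-- The coefficients of `(1 - v)^{-μ-1} (-log (1 - v))^k`. -/
lemma tendsto_logPowCoeff_succ (μ k : ℕ) :
    Tendsto (fun m => logPowCoeff (μ + 1) k m / (powLog μ k m : ℂ)) atTop
      (𝓝 (((1 / μ.factorial : ℝ) : ℝ) : ℂ)) := by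
  induction μ with
  | zero => simpa using tendsto_logPowCoeff_one k
  | succ μ ih =>
    have h2 := tendsto_sum_div' (by positivity) (powLog_mono (μ + 1) k)
      (tendsto_powLog (by omega)) (eventually_powLog_pos μ k) (tendsto_powLog_step μ k) ih
    have h3 : (1 / (μ.factorial : ℝ) / (μ + 1)) = 1 / ((μ + 1).factorial : ℝ) := by
      rw [Nat.factorial_succ]; push_cast; field_simp
    rw [h3] at h2
    simp only [logPowCoeff_succ (μ + 1)]
    exact tendsto_shift_div (u := fun m => ∑ j ∈ Finset.range m, logPowCoeff (μ + 1) k j)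
      (eventually_powLog_pos _ _) (tendsto_powLog_succ_div _ _) h2

end ArcAsymptotics

namespace ArcAsymptotics

lemma norm_le_pow_mul_norm {h : ℕ → ℂ} {R : ℝ} (hR : 0 ≤ R) {M : ℕ}
    (hM : ∀ m, M ≤ m → ‖h m‖ ≤ R * ‖h (m + 1)‖) {m : ℕ} (hm : M ≤ m) (j : ℕ) :
    ‖h m‖ ≤ R ^ j * ‖h (m + j)‖ := by
  induction j with
  | zero => simp
  | succ j ih =>
    calc ‖h m‖ ≤ R ^ j * ‖h (m + j)‖ := ih
      _ ≤ R ^ j * (R * ‖h (m + j + 1)‖) := by gcongr; exact hM _ (by omega)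
      _ = R ^ (j + 1) * ‖h (m + (j + 1))‖ := by rw [pow_succ, mul_assoc, add_assoc]

lemma exists_norm_div_le {h : ℕ → ℂ} {R : ℝ} (hR : 1 < R) (h0 : ∀ᶠ m in atTop, h m ≠ 0)
    (h1 : Tendsto (fun m => h m / h (m + 1)) atTop (𝓝 1)) :
    ∃ C : ℝ, ∀ᶠ N in atTop, ∀ k ≤ N, ‖h (N - k) / h N‖ ≤ C * R ^ k := by
  have h2 : ∀ᶠ m in atTop, ‖h m / h (m + 1)‖ < R :=
    h1.norm.eventually (gt_mem_nhds (by simpa using hR))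
  obtain ⟨M, hM⟩ := eventually_atTop.1 (h0.and h2)
  have hM1 : ∀ m, M ≤ m → ‖h m‖ ≤ R * ‖h (m + 1)‖ := fun m hm => by
    have := (hM m hm).2.le
    rwa [norm_div, div_le_iff₀ (norm_pos_iff.2 (hM (m + 1) (by omega)).1)] at this
  have hR0 : 0 ≤ R := by linarith
  set S := ∑ i ∈ Finset.range M, ‖h i‖ / ‖h M‖
  have hS : 0 ≤ S := Finset.sum_nonneg fun i _ => by positivity
  refine ⟨1 + S, ?_⟩
  filter_upwards [eventually_ge_atTop M] with N hN k hk
  have hpos : 0 < ‖h N‖ := norm_pos_iff.2 (hM N hN).1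
  rw [norm_div, div_le_iff₀ hpos]
  rcases le_or_gt M (N - k) with hc | hc
  · have := norm_le_pow_mul_norm hR0 hM1 hc k
    rw [Nat.sub_add_cancel hk] at this
    have h3 : 0 ≤ R ^ k * ‖h N‖ := by positivity
    nlinarith
  · have h3 := norm_le_pow_mul_norm hR0 hM1 le_rfl (N - M)
    rw [Nat.add_sub_cancel' hN] at h3
    have h4 : ‖h (N - k)‖ / ‖h M‖ ≤ S :=
      Finset.single_le_sum (f := fun i => ‖h i‖ / ‖h M‖) (fun i _ => by positivity)
        (Finset.mem_range.2 hc)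
    rw [div_le_iff₀ (norm_pos_iff.2 (hM M le_rfl).1)] at h4
    have h5 : R ^ (N - M) ≤ R ^ k := pow_le_pow_right₀ hR.le (by omega)
    calc ‖h (N - k)‖ ≤ S * ‖h M‖ := h4
      _ ≤ (1 + S) * (R ^ (N - M) * ‖h N‖) := by gcongr; linarith
      _ ≤ (1 + S) * (R ^ k * ‖h N‖) := by gcongr
      _ = (1 + S) * R ^ k * ‖h N‖ := by ring

lemma tendsto_sub_div {h : ℕ → ℂ} (h0 : ∀ᶠ m in atTop, h m ≠ 0)
    (h1 : Tendsto (fun m => h m / h (m + 1)) atTop (𝓝 1)) (k : ℕ) :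
    Tendsto (fun N => h (N - k) / h N) atTop (𝓝 1) := by
  induction k with
  | zero =>
    refine tendsto_const_nhds.congr' ?_
    filter_upwards [h0] with m hm
    simp [hm]
  | succ k ih =>
    have h2 := (h1.comp (tendsto_sub_atTop_nat (k + 1))).mul ih
    rw [one_mul] at h2
    refine h2.congr' ?_
    filter_upwards [(tendsto_sub_atTop_nat k).eventually h0, eventually_ge_atTop (k + 1)]
      with N hN hk
    have : N - (k + 1) + 1 = N - k := by omega
    simp only [Function.comp, this]
    rw [div_mul_div_cancel₀ hN]

/-- Convolution of a geometrically small sequence with a slowly varying one. -/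
lemma tendsto_conv_div {f h : ℕ → ℂ} {R : ℝ} (hR : 1 < R) (hf : Summable fun k => ‖f k‖ * R ^ k)
    (h0 : ∀ᶠ m in atTop, h m ≠ 0) (h1 : Tendsto (fun m => h m / h (m + 1)) atTop (𝓝 1)) :
    Tendsto (fun N => (∑ k ∈ Finset.range (N + 1), f k * h (N - k)) / h N) atTop
      (𝓝 (∑' k, f k)) := by
  obtain ⟨C, hC⟩ := exists_norm_div_le hR h0 h1
  have key := tendsto_tsum_of_dominated_convergence (𝓕 := atTop)
    (f := fun N k => if k ≤ N then f k * (h (N - k) / h N) else 0) (g := f)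
    (bound := fun k => |C| * (‖f k‖ * R ^ k)) (hf.mul_left _) (fun k => ?_) ?_
  · refine key.congr fun N => ?_
    rw [tsum_eq_sum (s := Finset.range (N + 1)), Finset.sum_div]
    · refine Finset.sum_congr rfl fun k hk => ?_
      rw [if_pos (by simpa [Nat.lt_succ_iff] using hk), mul_div_assoc]
    · intro k hk
      rw [if_neg (by simpa [Nat.lt_succ_iff] using hk)]
  · have := (tendsto_sub_div h0 h1 k).const_mul (f k)
    rw [mul_one] at this
    refine this.congr' ?_
    filter_upwards [eventually_ge_atTop k] with N hN
    rw [if_pos hN]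
  · filter_upwards [hC] with N hN k
    split_ifs with hk
    · rw [norm_mul]
      calc ‖f k‖ * ‖h (N - k) / h N‖ ≤ ‖f k‖ * (|C| * R ^ k) := by
            gcongr
            exact (hN k hk).trans (by gcongr; exact le_abs_self C)
        _ = _ := by ring
    · rw [norm_zero]; positivity

lemma tendsto_half : Tendsto (fun N : ℕ => N / 2) atTop atTop :=
  tendsto_atTop.2 fun b => by
    filter_upwards [eventually_ge_atTop (2 * b)] with N hN
    omega

lemma tendsto_half_ratio {h : ℕ → ℂ} (h0 : ∀ᶠ m in atTop, h m ≠ 0)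
    (h1 : Tendsto (fun m => h m / h (m + 1)) atTop (𝓝 1)) :
    Tendsto (fun N : ℕ => h (N / 2) / h ((N + 1) / 2)) atTop (𝓝 1) := by
  intro s hs
  change ∀ᶠ N : ℕ in atTop, h (N / 2) / h ((N + 1) / 2) ∈ s
  filter_upwards [(h1.comp tendsto_half) hs, tendsto_half.eventually h0] with N hN hN0
  rcases Nat.even_or_odd' N with ⟨m, rfl | rfl⟩
  · have e1 : (2 * m + 1) / 2 = 2 * m / 2 := by omega
    rw [e1, div_self hN0]
    exact mem_of_mem_nhds hs
  · have e1 : (2 * m + 1 + 1) / 2 = (2 * m + 1) / 2 + 1 := by omega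
    simpa [e1] using hN

lemma one_add_neg_one_pow_div_two (m : ℕ) :
    (1 + (-1 : ℂ) ^ m) / 2 = if Even m then 1 else 0 := by
  split_ifs with h
  · rw [h.neg_one_pow]; norm_num
  · rw [(Nat.not_even_iff_odd.1 h).neg_one_pow]; norm_num

/-- Coefficient asymptotics of `G(z) H(c² z²)`, where `G` has parity `n` and is holomorphic beyond
the singularity `1 / c` of `H(c² z²)`. -/
lemma isEquivalent_taylorCoeff {F G H : ℂ → ℂ} {h : ℕ → ℂ} {K : ℂ} {c R ρ : ℝ} {n : ℕ}
    (hc : 0 < c) (hρ : 0 < ρ) (hρc : ρ ≤ 1 / c) (hRc : 1 / c < R)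
    (hG : DifferentiableOn ℂ G (Metric.ball 0 R))
    (hpar : ∀ z : ℂ, ‖z‖ < R → G (-z) = (-1) ^ n * G z)
    (hG0 : G (1 / c) ≠ 0) (hH : HasPS 1 H h)
    (hF : ∀ z : ℂ, ‖z‖ < ρ → F z = K * G z * H ((c * z) ^ 2))
    (h0 : ∀ᶠ m in atTop, h m ≠ 0) (h1 : Tendsto (fun m => h m / h (m + 1)) atTop (𝓝 1)) :
    Asymptotics.IsEquivalent atTop (fun N : ℕ => taylorCoeff F N)
      (fun N : ℕ => (1 + (-1 : ℂ) ^ (n + N)) / 2 * (K * G (1 / c) * (c : ℂ) ^ N * h (N / 2))) := by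
  have hR : 0 < R := lt_trans (by positivity) hRc
  have hGPS := hasPS_taylorCoeff hG
  have hcC : (c : ℂ) ≠ 0 := by exact_mod_cast hc.ne'
  set f : ℕ → ℂ := fun k => taylorCoeff G k * (1 / c : ℂ) ^ k with hf
  obtain ⟨r, hr1, hr2⟩ := exists_between hRc
  have hr0 : 0 < r := lt_trans (by positivity) hr1
  have hfs : Summable fun k => ‖f k‖ * (r * c) ^ k := by
    refine (hGPS.summable_norm hr0.le hr2).congr fun k => ?_
    simp only [hf, norm_mul, norm_pow, norm_div, norm_one, Complex.norm_real, Real.norm_eq_abs,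
      abs_of_pos hc, mul_pow, div_pow, one_pow]
    field_simp
  have hsum : ∑' k, f k = G (1 / c) := by
    refine (hGPS (1 / c) ?_).tsum_eq
    simpa [abs_of_pos hc] using hRc
  have key := tendsto_conv_div (h := fun N => h (N / 2)) (by rwa [div_lt_iff₀ hc] at hr1) hfs
    (tendsto_half.eventually h0) (tendsto_half_ratio h0 h1)
  rw [hsum] at key
  have hnorm : ∀ z : ℂ, ‖z‖ < ρ → ‖(c : ℂ) * z‖ < 1 := fun z hz => by
    rw [norm_mul, Complex.norm_real, Real.norm_eq_abs, abs_of_pos hc, mul_comm, ← lt_div_iff₀ hc]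
    exact hz.trans_le hρc
  have hH2 : HasPS 1 (fun z => H (z ^ 2)) (fun N => if Even N then h (N / 2) else 0) :=
    hH.comp_sq fun z hz => by rw [norm_pow]; exact pow_lt_one₀ (norm_nonneg z) hz two_ne_zero
  have hcoef := fun N => (((((hGPS.mono (hρc.trans hRc.le)).const_mul K).mul
    (hH2.scale (a := c) hnorm)).congr (g := F) hF).taylorCoeff_eq hρ N)
  have hcoef' : ∀ N, taylorCoeff F N = (1 + (-1 : ℂ) ^ (n + N)) / 2 * (K * (c : ℂ) ^ N) *
      ∑ k ∈ Finset.range (N + 1), f k * h ((N - k) / 2) := by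
    intro N
    rw [hcoef, Finset.Nat.sum_antidiagonal_eq_sum_range_succ_mk, Finset.mul_sum]
    refine Finset.sum_congr rfl fun k hk => ?_
    have hkN : k ≤ N := by simpa [Nat.lt_succ_iff] using hk
    rw [one_add_neg_one_pow_div_two]
    simp only [hf]
    rcases Nat.even_or_odd (n + k) with hp | hp
    · have : Even (n + N) ↔ Even (N - k) := by
        rw [Nat.even_sub hkN, Nat.even_add]
        rw [Nat.even_add] at hp
        tauto
      simp only [this]
      split_ifs
      · rw [one_div, inv_pow, ← Nat.sub_add_cancel hkN, pow_add, Nat.add_sub_cancel]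
        field_simp
      · simp
    · rw [taylorCoeff_eq_zero_of_parity hR hG hpar hp]; simp
  rw [Asymptotics.isEquivalent_iff_exists_eq_mul]
  refine ⟨fun N => ((∑ k ∈ Finset.range (N + 1), f k * h ((N - k) / 2)) / h (N / 2)) / G (1 / c),
    ?_, ?_⟩
  · have := key.div_const (G (1 / c))
    rwa [div_self hG0] at this
  · filter_upwards [tendsto_half.eventually h0] with N hN
    rw [hcoef' N]
    simp only [Pi.mul_apply]
    field_simp

/-- Slow variation is inherited from an asymptotic comparison. -/
lemma slowly_varying_of_tendsto {h : ℕ → ℂ} {w : ℕ → ℝ} {a : ℂ} (ha : a ≠ 0)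
    (hw : ∀ᶠ m in atTop, 0 < w m) (hw' : Tendsto (fun m => w (m + 1) / w m) atTop (𝓝 1))
    (h1 : Tendsto (fun m => h m / (w m : ℂ)) atTop (𝓝 a)) :
    (∀ᶠ m in atTop, h m ≠ 0) ∧ Tendsto (fun m => h m / h (m + 1)) atTop (𝓝 1) := by
  refine ⟨?_, ?_⟩
  · filter_upwards [h1.eventually_ne ha] with m hm h0
    simp [h0] at hm
  · have h2 := h1.div (tendsto_shift_div hw hw' h1) ha
    rw [div_self ha] at h2
    refine h2.congr' ?_
    filter_upwards [hw] with m hm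
    have : (w m : ℂ) ≠ 0 := by exact_mod_cast hm.ne'
    simp only [Pi.div_apply]
    rw [div_div_div_cancel_right₀ this]

lemma factorial_inv_ne_zero (μ : ℕ) : (((1 / μ.factorial : ℝ) : ℝ) : ℂ) ≠ 0 := by
  have : (μ.factorial : ℂ) ≠ 0 := by exact_mod_cast μ.factorial_ne_zero
  push_cast
  exact one_div_ne_zero this

lemma logPowCoeff_succ_slowly_varying (μ k : ℕ) :
    (∀ᶠ m in atTop, logPowCoeff (μ + 1) k m ≠ 0) ∧
      Tendsto (fun m => logPowCoeff (μ + 1) k m / logPowCoeff (μ + 1) k (m + 1)) atTop (𝓝 1) :=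
  slowly_varying_of_tendsto (factorial_inv_ne_zero μ) (eventually_powLog_pos μ k)
    (tendsto_powLog_succ_div μ k) (tendsto_logPowCoeff_succ μ k)

lemma logPowCoeff_zero_slowly_varying (k : ℕ) :
    (∀ᶠ m in atTop, logPowCoeff 0 (k + 1) m ≠ 0) ∧
      Tendsto (fun m => logPowCoeff 0 (k + 1) m / logPowCoeff 0 (k + 1) (m + 1)) atTop (𝓝 1) := by
  refine slowly_varying_of_tendsto (by exact_mod_cast k.succ_ne_zero) ?_ ?_
    (tendsto_logPowCoeff_zero k)
  · filter_upwards [eventually_gt_atTop 0, eventually_powLog_pos 0 k] with m hm hl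
    have : (0 : ℝ) < m := by exact_mod_cast hm
    positivity
  · have := (tendsto_powLog_succ_div 0 k).div tendsto_succ_div one_ne_zero
    rw [div_one] at this
    refine this.congr fun m => ?_
    simp only [Pi.div_apply]
    rw [div_div_div_comm]

lemma tendsto_half_div : Tendsto (fun N : ℕ => ((N / 2 : ℕ) : ℝ) / (N / 2 : ℝ)) atTop (𝓝 1) := by
  have h1 : Tendsto (fun N : ℕ => 1 - 2 * (N : ℝ)⁻¹) atTop (𝓝 (1 - 2 * 0)) :=
    tendsto_const_nhds.sub (tendsto_inv_atTop_nhds_zero_nat.const_mul 2)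
  rw [mul_zero, sub_zero] at h1
  refine tendsto_of_tendsto_of_tendsto_of_le_of_le' h1 tendsto_const_nhds ?_ ?_
  all_goals
    filter_upwards [eventually_gt_atTop 0] with N hN
    have hN' : (0 : ℝ) < N := by exact_mod_cast hN
  · rw [le_div_iff₀ (by positivity)]
    have : (N : ℝ) ≤ 2 * ((N / 2 : ℕ) : ℝ) + 1 := by exact_mod_cast (by omega)
    field_simp
    linarith
  · rw [div_le_one (by positivity)]
    exact Nat.cast_div_le

lemma tendsto_log_half_div :
    Tendsto (fun N : ℕ => Real.log ((N / 2 : ℕ) : ℝ) / Real.log N) atTop (𝓝 1) := by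
  have h1 := ((tendsto_half_div.log one_ne_zero).sub_const (Real.log 2)).mul
    tendsto_log_natCast.inv_tendsto_atTop |>.add_const 1
  rw [mul_zero, zero_add] at h1
  refine h1.congr' ?_
  filter_upwards [eventually_ge_atTop 2, eventually_log_pos] with N hN hl
  have hN' : (0 : ℝ) < N := by exact_mod_cast (by omega)
  have hN2 : (0 : ℝ) < (N / 2 : ℕ) := by exact_mod_cast (by omega)
  simp only [Pi.inv_apply]
  rw [Real.log_div hN2.ne' (by positivity), Real.log_div hN'.ne' (by positivity)]
  field_simp
  ring

lemma isEquivalent_half_of_tendsto {h : ℕ → ℂ} {w v : ℕ → ℝ} {a : ℂ}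
    (hw : ∀ᶠ m in atTop, 0 < w m) (h1 : Tendsto (fun m => h m / (w m : ℂ)) atTop (𝓝 a))
    (ha : a ≠ 0) (hv : Tendsto (fun N => w (N / 2) / v N) atTop (𝓝 1)) :
    Asymptotics.IsEquivalent atTop (fun N => h (N / 2)) (fun N => a * (v N : ℂ)) := by
  rw [Asymptotics.isEquivalent_iff_exists_eq_mul]
  have h2 := ((h1.comp tendsto_half).div_const a).mul
    ((Complex.continuous_ofReal.tendsto 1).comp hv)
  rw [div_self ha, Complex.ofReal_one, mul_one] at h2
  refine ⟨_, h2, ?_⟩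
  filter_upwards [tendsto_half.eventually hw, hv.eventually_ne one_ne_zero] with N hN hvN
  have h3 : (w (N / 2) : ℂ) ≠ 0 := by exact_mod_cast hN.ne'
  have h4 : (v N : ℂ) ≠ 0 := by
    intro h0
    have : v N = 0 := by exact_mod_cast h0
    simp [this] at hvN
  simp only [Function.comp, Pi.mul_apply, Complex.ofReal_div]
  field_simp

lemma isEquivalent_logPowCoeff_succ_half (μ k : ℕ) :
    Asymptotics.IsEquivalent atTop (fun N => logPowCoeff (μ + 1) k (N / 2))
      (fun N => ((1 / μ.factorial : ℝ) : ℂ) *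
        (((N / 2 : ℝ) ^ μ * Real.log N ^ k : ℝ) : ℂ)) := by
  refine isEquivalent_half_of_tendsto (v := fun N : ℕ => (N / 2 : ℝ) ^ μ * Real.log N ^ k)
    (eventually_powLog_pos μ k) (tendsto_logPowCoeff_succ μ k)
    (factorial_inv_ne_zero μ) ?_
  have := (tendsto_half_div.pow μ).mul (tendsto_log_half_div.pow k)
  simp only [one_pow, mul_one] at this
  refine this.congr fun N => ?_
  rw [powLog, mul_div_mul_comm, ← div_pow, ← div_pow]

lemma isEquivalent_logPowCoeff_zero_half (k : ℕ) :
    Asymptotics.IsEquivalent atTop (fun N => logPowCoeff 0 (k + 1) (N / 2))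
      (fun N => ((k + 1 : ℝ) : ℂ) * ((Real.log N ^ k / (N / 2 : ℝ) : ℝ) : ℂ)) := by
  refine isEquivalent_half_of_tendsto (v := fun N : ℕ => Real.log N ^ k / (N / 2 : ℝ)) ?_
    (tendsto_logPowCoeff_zero k) (by exact_mod_cast k.succ_ne_zero) ?_
  · filter_upwards [eventually_gt_atTop 0, eventually_powLog_pos 0 k] with m hm hl
    have : (0 : ℝ) < m := by exact_mod_cast hm
    positivity
  · have := (tendsto_log_half_div.pow k).div tendsto_half_div one_ne_zero
    rw [one_pow, div_one] at this
    refine this.congr fun N => ?_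
    simp only [Pi.div_apply, powLog, pow_zero, one_mul]
    rw [div_pow, div_div_div_comm]

end ArcAsymptotics

namespace ArcAsymptotics

lemma sum_units_pow (m : ℕ) : ∑ u : ℤˣ, ((u : ℤ) : ℝ) ^ m = 1 + (-1) ^ m := by
  rw [show (Finset.univ : Finset ℤˣ) = {1, -1} from rfl, Finset.sum_pair (by decide)]
  simp

/-- A product of functions of signs with positive Fourier coefficients on the subsets of covering
supports has positive top Fourier coefficient. -/
lemma sum_signs_pos {n r : ℕ} (f : Fin r → (Fin n → ℤˣ) → ℝ) (S : Fin r → Finset (Fin n))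
    (a : Fin r → Finset (Fin n) → ℝ) (ha : ∀ i T, 0 < a i T)
    (hf : ∀ i ε, f i ε = ∑ T ∈ (S i).powerset, a i T * ∏ j ∈ T, ((ε j : ℤ) : ℝ))
    (hS : ∀ j, ∃ i, j ∈ S i) :
    0 < ∑ ε : Fin n → ℤˣ, (∏ j, ((ε j : ℤ) : ℝ)) * ∏ i, f i ε := by
  classical
  have hmono : ∀ (τ : Fin r → Finset (Fin n)) (ε : Fin n → ℤˣ),
      (∏ j, ((ε j : ℤ) : ℝ)) * ∏ i, ∏ j ∈ τ i, ((ε j : ℤ) : ℝ) =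
        ∏ j, ((ε j : ℤ) : ℝ) ^ (1 + (Finset.univ.filter fun i => j ∈ τ i).card) := by
    intro τ ε
    have h1 : ∀ i, ∏ j ∈ τ i, ((ε j : ℤ) : ℝ) = ∏ j, if j ∈ τ i then ((ε j : ℤ) : ℝ) else 1 :=
      fun i => by rw [Finset.prod_ite_mem, Finset.univ_inter]
    simp only [h1]
    rw [Finset.prod_comm, ← Finset.prod_mul_distrib]
    refine Finset.prod_congr rfl fun j _ => ?_
    rw [pow_add, pow_one, Finset.prod_ite, Finset.prod_const, Finset.prod_const_one, mul_one]
  have hsum : ∑ ε : Fin n → ℤˣ, (∏ j, ((ε j : ℤ) : ℝ)) * ∏ i, f i ε =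
      ∑ τ ∈ Fintype.piFinset fun i => (S i).powerset, (∏ i, a i (τ i)) *
        ∏ j, (1 + (-1 : ℝ) ^ (1 + (Finset.univ.filter fun i => j ∈ τ i).card)) := by
    simp only [hf, Finset.prod_univ_sum, Finset.mul_sum]
    rw [Finset.sum_comm]
    refine Finset.sum_congr rfl fun τ _ => ?_
    simp only [← sum_units_pow, Finset.prod_univ_sum, Fintype.piFinset_univ, Finset.mul_sum,
      ← hmono, Finset.prod_mul_distrib]
    refine Finset.sum_congr rfl fun ε _ => ?_
    ring
  rw [hsum]
  have hnn : ∀ m : ℕ, (0 : ℝ) ≤ 1 + (-1) ^ m := fun m => by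
    rcases neg_one_pow_eq_or ℝ m with h | h <;> rw [h] <;> norm_num
  choose φ hφ using hS
  refine Finset.sum_pos' (fun τ _ => mul_nonneg (Finset.prod_nonneg fun i _ => (ha _ _).le)
    (Finset.prod_nonneg fun j _ => hnn _)) ⟨fun i => Finset.univ.filter fun j => φ j = i, ?_, ?_⟩
  · rw [Fintype.mem_piFinset]
    intro i
    rw [Finset.mem_powerset]
    intro j hj
    have : φ j = i := by simpa using hj
    exact this ▸ hφ j
  · refine mul_pos (Finset.prod_pos fun i _ => ha _ _) (Finset.prod_pos fun j _ => ?_)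
    have : (Finset.univ.filter fun i => j ∈ Finset.univ.filter fun j => φ j = i).card = 1 := by
      simp [Finset.filter_eq]
    rw [this]; norm_num

variable {n r : ℕ}

/-- The signed row sum `∑_j ε_j c_{i,j}`. -/
def signedSum (a : ArcDatum n r) (ε : Fin n → ℤˣ) (i : Fin r) : ℤ := ∑ j, (ε j : ℤ) * a.c i j

lemma ArcDatum.row_cases (a : ArcDatum n r) (i : Fin r) :
    (∃ j, a.c i j = 2 ∧ ∀ l, l ≠ j → a.c i l = 0) ∨
      ∃ j k, j ≠ k ∧ a.c i j = 1 ∧ a.c i k = 1 ∧ ∀ l, l ≠ j → l ≠ k → a.c i l = 0 := by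
  have hsum := a.row_sum i
  have h1 : ∃ j, a.c i j ≠ 0 := by
    by_contra! h
    simp [h] at hsum
  obtain ⟨j, hj⟩ := h1
  rw [← Finset.add_sum_erase _ _ (Finset.mem_univ j)] at hsum
  have h2 := a.c_le_two i j
  rcases Nat.lt_or_ge 1 (a.c i j) with hc | hc
  · left
    refine ⟨j, by omega, fun l hl => ?_⟩
    have h3 : ∑ x ∈ Finset.univ.erase j, a.c i x = 0 := by omega
    exact Finset.sum_eq_zero_iff.1 h3 l (by simp [hl])
  · right
    have h3 : ∑ x ∈ Finset.univ.erase j, a.c i x = 1 := by omega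
    have h4 : ∃ k ∈ Finset.univ.erase j, a.c i k ≠ 0 := by
      by_contra! h
      rw [Finset.sum_eq_zero h] at h3
      omega
    obtain ⟨k, hk, hk0⟩ := h4
    rw [← Finset.add_sum_erase _ _ hk] at h3
    refine ⟨j, k, fun h => by simp [h] at hk, by omega, by omega, fun l hl hl' => ?_⟩
    have h5 : ∑ x ∈ (Finset.univ.erase j).erase k, a.c i x = 0 := by omega
    exact Finset.sum_eq_zero_iff.1 h5 l (by simp [hl, hl'])

lemma signedSum_eq_two_mul (a : ArcDatum n r) {i : Fin r} {j : Fin n} (h : a.c i j = 2)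
    (h0 : ∀ l, l ≠ j → a.c i l = 0) (ε : Fin n → ℤˣ) : signedSum a ε i = 2 * (ε j : ℤ) := by
  rw [signedSum, Finset.sum_eq_single j (fun l _ hl => by simp [h0 l hl]) (by simp), h]
  push_cast; ring

lemma signedSum_eq_add (a : ArcDatum n r) {i : Fin r} {j k : Fin n} (hjk : j ≠ k)
    (hj : a.c i j = 1) (hk : a.c i k = 1) (h0 : ∀ l, l ≠ j → l ≠ k → a.c i l = 0)
    (ε : Fin n → ℤˣ) : signedSum a ε i = (ε j : ℤ) + (ε k : ℤ) := by
  rw [signedSum, ← Finset.sum_subset (Finset.subset_univ {j, k}), Finset.sum_pair hjk, hj, hk]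
  · simp
  · intro l _ hl
    simp only [Finset.mem_insert, Finset.mem_singleton, not_or] at hl
    simp [h0 l hl.1 hl.2]

lemma signedSum_cases (a : ArcDatum n r) (ε : Fin n → ℤˣ) (i : Fin r) :
    signedSum a ε i = 2 ∨ signedSum a ε i = 0 ∨ signedSum a ε i = -2 := by
  rcases a.row_cases i with ⟨j, h, h0⟩ | ⟨j, k, hjk, hj, hk, h0⟩
  · rw [signedSum_eq_two_mul a h h0]
    rcases Int.units_eq_one_or (ε j) with h1 | h1 <;> simp [h1]
  · rw [signedSum_eq_add a hjk hj hk h0]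
    rcases Int.units_eq_one_or (ε j) with h1 | h1 <;>
      rcases Int.units_eq_one_or (ε k) with h2 | h2 <;> simp [h1, h2]

/-- Convexity and monotonicity conditions making all Fourier coefficients positive. -/
def IsSignConvex (g : ℤ → ℝ) : Prop := g (-2) < g 2 ∧ 2 * g 0 < g 2 + g (-2) ∧ 0 ≤ g 0

lemma exists_fourier (a : ArcDatum n r) (i : Fin r) {g : ℤ → ℝ} (hg : IsSignConvex g) :
    ∃ b : Finset (Fin n) → ℝ, (∀ T, 0 < b T) ∧ ∀ ε : Fin n → ℤˣ, g (signedSum a ε i) =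
      ∑ T ∈ (Finset.univ.filter fun j => 0 < a.c i j).powerset,
        b T * ∏ j ∈ T, ((ε j : ℤ) : ℝ) := by
  obtain ⟨h1, h2, h3⟩ := hg
  rcases a.row_cases i with ⟨j, h, h0⟩ | ⟨j, k, hjk, hj, hk, h0⟩
  · refine ⟨fun T => if T.card = 0 then (g 2 + g (-2)) / 2 else (g 2 - g (-2)) / 2,
      fun T => by dsimp only; split_ifs <;> linarith, fun ε => ?_⟩
    have hs : (Finset.univ.filter fun j => 0 < a.c i j) = insert j ∅ := by
      ext l
      by_cases hl : l = j
      · simp [hl, h]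
      · simp [hl, h0 l hl]
    rw [hs, Finset.sum_powerset_insert (by simp), signedSum_eq_two_mul a h h0]
    rcases Int.units_eq_one_or (ε j) with e1 | e1 <;> simp [e1] <;> ring
  · refine ⟨fun T => if T.card = 0 then (g 2 + 2 * g 0 + g (-2)) / 4 else if T.card = 1 then
      (g 2 - g (-2)) / 4 else (g 2 - 2 * g 0 + g (-2)) / 4,
      fun T => by dsimp only; split_ifs <;> linarith, fun ε => ?_⟩
    have hs : (Finset.univ.filter fun j => 0 < a.c i j) = insert j (insert k ∅) := by
      ext l
      by_cases hl : l = j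
      · simp [hl, hj]
      · by_cases hl' : l = k
        · simp [hl', hk]
        · simp [hl, hl', h0 l hl hl']
    rw [hs, Finset.sum_powerset_insert (by simp [hjk]), Finset.sum_powerset_insert (by simp),
      Finset.sum_powerset_insert (by simp), signedSum_eq_add a hjk hj hk h0]
    rcases Int.units_eq_one_or (ε j) with e1 | e1 <;>
      rcases Int.units_eq_one_or (ε k) with e2 | e2 <;> simp [e1, e2, hjk] <;> ring

lemma sum_signs_prod_pos (a : ArcDatum n r) (g : Fin r → ℤ → ℝ) (hg : ∀ i, IsSignConvex (g i)) :
    0 < ∑ ε : Fin n → ℤˣ, (∏ j, ((ε j : ℤ) : ℝ)) * ∏ i, g i (signedSum a ε i) := by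
  choose b hb hb' using fun i => exists_fourier a i (hg i)
  refine sum_signs_pos (fun i ε => g i (signedSum a ε i)) _ b hb hb' fun j => ?_
  have h := a.col_sum_pos j
  obtain ⟨i, -, hi⟩ := Finset.exists_ne_zero_of_sum_ne_zero h.ne'
  exact ⟨i, by simpa using Nat.pos_of_ne_zero hi⟩

lemma isSignConvex_inv {ι x : ℝ} (hx : 0 < x) (hι : 2 * x < ι) :
    IsSignConvex fun s => 1 / (ι - s * x) := by
  have h1 : 0 < ι - 2 * x := by linarith
  have h2 : 0 < ι + 2 * x := by linarith
  have h3 : 0 < ι := by linarith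
  refine ⟨?_, ?_, ?_⟩
  · push_cast
    exact one_div_lt_one_div_of_lt h1 (by linarith)
  · push_cast
    rw [show ι - -2 * x = ι + 2 * x by ring, show ι - 0 * x = ι by ring,
      div_add_div _ _ h1.ne' h2.ne', mul_one_div, div_lt_div_iff₀ h3 (by positivity)]
    nlinarith [mul_pos h3 (mul_pos hx hx), mul_pos hx hx]
  · push_cast; rw [zero_mul, sub_zero]; positivity

lemma isSignConvex_indicator {t : ℝ} (ht : 0 < t) :
    IsSignConvex fun s => if s = 2 then t else 0 := by
  refine ⟨?_, ?_, ?_⟩ <;> norm_num <;> exact ht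

end ArcAsymptotics

namespace ArcAsymptotics

variable {n r n' : ℕ}

/-- The nonnegative orthant of `ℝ^r × ℝ^{n'}`. -/
def orthant (r n' : ℕ) : Set ((Fin r → ℝ) × (Fin n' → ℝ)) :=
  {p | (∀ i, 0 ≤ p.1 i) ∧ ∀ k, 0 ≤ p.2 k}

/-- `P` gives the power series coefficients of a family `g` of entire functions parametrised by
`ℝ^r × ℝ^{n'}`; they are continuous, nonnegative on the orthant, and the coefficient of order `N`
is homogeneous of degree `N - e`. -/
structure IsCoeffFamily (g : (Fin r → ℝ) × (Fin n' → ℝ) → ℂ → ℂ) (e : ℕ)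
    (P : (Fin r → ℝ) × (Fin n' → ℝ) → ℕ → ℝ) : Prop where
  cont : ∀ N, Continuous fun p => P p N
  nonneg : ∀ p ∈ orthant r n', ∀ N, 0 ≤ P p N
  homog : ∀ t : ℝ, 0 < t → ∀ p N, t ^ e * P (t • p) N = t ^ N * P p N
  hasPS : ∀ p R, HasPS R (g p) fun N => (P p N : ℂ)

lemma isCoeffFamily_one : IsCoeffFamily (r := r) (n' := n') (fun _ _ => 1) 0
    (fun _ N => if N = 0 then 1 else 0) where
  cont N := continuous_const
  nonneg p _ N := by split_ifs <;> norm_num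
  homog t _ p N := by
    split_ifs with h <;> simp [h]
  hasPS p R z _ := by
    convert hasSum_single (f := fun N => (((if N = 0 then 1 else 0 : ℝ)) : ℂ) * z ^ N) 0 ?_ using 1
    · simp
    · intro N hN; simp [hN]

lemma IsCoeffFamily.mul {g₁ g₂ : (Fin r → ℝ) × (Fin n' → ℝ) → ℂ → ℂ} {e₁ e₂ : ℕ}
    {P₁ P₂ : (Fin r → ℝ) × (Fin n' → ℝ) → ℕ → ℝ} (h₁ : IsCoeffFamily g₁ e₁ P₁)
    (h₂ : IsCoeffFamily g₂ e₂ P₂) :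
    IsCoeffFamily (fun p z => g₁ p z * g₂ p z) (e₁ + e₂)
      (fun p N => ∑ kl ∈ Finset.HasAntidiagonal.antidiagonal N, P₁ p kl.1 * P₂ p kl.2) where
  cont N := continuous_finsetSum _ fun kl _ => (h₁.cont _).mul (h₂.cont _)
  nonneg p hp N := Finset.sum_nonneg fun kl _ => mul_nonneg (h₁.nonneg p hp _) (h₂.nonneg p hp _)
  homog t ht p N := by
    rw [Finset.mul_sum, Finset.mul_sum]
    refine Finset.sum_congr rfl fun kl hkl => ?_
    rw [← Finset.HasAntidiagonal.mem_antidiagonal.1 hkl, pow_add, pow_add]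
    linear_combination t ^ e₁ * P₁ (t • p) kl.1 * h₂.homog t ht p kl.2 +
      t ^ kl.2 * P₂ p kl.2 * h₁.homog t ht p kl.1
  hasPS p R := by
    have := (h₁.hasPS p R).mul (h₂.hasPS p R)
    simpa using this

lemma exists_isCoeffFamily_prod {ι : Type*} (s : Finset ι)
    {g : ι → (Fin r → ℝ) × (Fin n' → ℝ) → ℂ → ℂ} {e : ℕ}
    (h : ∀ i, ∃ P, IsCoeffFamily (g i) e P) :
    ∃ P, IsCoeffFamily (fun p z => ∏ i ∈ s, g i p z) (s.card * e) P := by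
  classical
  induction s using Finset.induction_on with
  | empty => exact ⟨_, by simpa using isCoeffFamily_one⟩
  | insert i s hi ih =>
    obtain ⟨P, hP⟩ := ih
    obtain ⟨Q, hQ⟩ := h i
    have := hQ.mul hP
    simp only [Finset.prod_insert hi]
    rw [Finset.card_insert_of_notMem hi, add_mul, one_mul, add_comm]
    exact ⟨_, this⟩

lemma hasSum_cexp (z : ℂ) : HasSum (fun N : ℕ => z ^ N / (N.factorial : ℂ)) (Complex.exp z) := by
  rw [Complex.exp_eq_exp_ℂ]
  exact NormedSpace.expSeries_div_hasSum_exp z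

/-- Taylor coefficients of `sinh`. -/
def sinhCoeff (N : ℕ) : ℝ := (1 - (-1) ^ N) / (2 * N.factorial)

lemma sinhCoeff_nonneg (N : ℕ) : 0 ≤ sinhCoeff N := by
  refine div_nonneg ?_ (by positivity)
  rcases neg_one_pow_eq_or ℝ N with h | h <;> rw [h] <;> norm_num

lemma hasSum_sinh (w : ℂ) : HasSum (fun N => (sinhCoeff N : ℂ) * w ^ N) (Complex.sinh w) := by
  have h := ((hasSum_cexp w).sub (hasSum_cexp (-w))).div_const 2
  rw [Complex.sinh]
  refine h.congr_fun fun N => ?_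
  rw [sinhCoeff, neg_pow w]
  push_cast
  have : (N.factorial : ℂ) ≠ 0 := by exact_mod_cast N.factorial_ne_zero
  field_simp

/-- Taylor coefficients of `sinh²`. -/
def sinhSqCoeff (N : ℕ) : ℝ := (2 ^ N + (-2) ^ N) / (4 * N.factorial) - if N = 0 then 1 / 2 else 0

lemma sinhSqCoeff_zero : sinhSqCoeff 0 = 0 := by norm_num [sinhSqCoeff]

lemma sinhSqCoeff_one : sinhSqCoeff 1 = 0 := by norm_num [sinhSqCoeff]

lemma sinhSqCoeff_nonneg (N : ℕ) : 0 ≤ sinhSqCoeff N := by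
  rcases Nat.eq_zero_or_pos N with rfl | hN
  · rw [sinhSqCoeff_zero]
  · rw [sinhSqCoeff, if_neg hN.ne', sub_zero]
    refine div_nonneg ?_ (by positivity)
    rcases Nat.even_or_odd N with h | h
    · rw [h.neg_pow]; positivity
    · rw [h.neg_pow]; simp

lemma hasSum_sinh_sq (w : ℂ) :
    HasSum (fun N => (sinhSqCoeff N : ℂ) * w ^ N) (Complex.sinh w ^ 2) := by
  have h0 : HasSum (fun N : ℕ => if N = 0 then (1 / 2 : ℂ) else 0) (1 / 2) := by
    simpa using hasSum_ite_eq (0 : ℕ) (1 / 2 : ℂ)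
  have h := (((hasSum_cexp (2 * w)).add (hasSum_cexp (-(2 * w)))).div_const 4).sub h0
  have e : Complex.sinh w ^ 2 = (Complex.exp (2 * w) + Complex.exp (-(2 * w))) / 4 - 1 / 2 := by
    have : Complex.exp w * Complex.exp (-w) = 1 := by rw [← Complex.exp_add]; simp
    rw [Complex.sinh, two_mul, neg_add, Complex.exp_add, Complex.exp_add]
    linear_combination (-1 / 2 : ℂ) * this
  rw [e]
  refine h.congr_fun fun N => ?_
  rw [sinhSqCoeff, ← neg_mul, mul_pow, mul_pow]
  have : (N.factorial : ℂ) ≠ 0 := by exact_mod_cast N.factorial_ne_zero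
  split_ifs with hN
  · subst hN; norm_num
  · push_cast
    field_simp
    ring

lemma isCoeffFamily_sinh (a : ArcDatum n r) (j : Fin n) :
    IsCoeffFamily (n' := n') (fun p z => Complex.sinh ((bdry a p.1 j : ℂ) * z)) 0
      (fun p N => sinhCoeff N * bdry a p.1 j ^ N) where
  cont N := by unfold bdry; fun_prop
  nonneg p hp N := mul_nonneg (sinhCoeff_nonneg N) (pow_nonneg
    (Finset.sum_nonneg fun i _ => mul_nonneg (Nat.cast_nonneg _) (hp.1 i)) _)
  homog t _ p N := by
    have : bdry a (t • p).1 j = t * bdry a p.1 j := by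
      simp only [bdry, Prod.smul_fst, Pi.smul_apply, smul_eq_mul, Finset.mul_sum]
      exact Finset.sum_congr rfl fun i _ => by ring
    rw [this, mul_pow]; ring
  hasPS p R z _ := by
    refine (hasSum_sinh _).congr_fun fun N => ?_
    push_cast; rw [mul_pow]; ring

lemma hasSum_sinh_sq_div (x : ℝ) (z : ℂ) :
    HasSum (fun N => ((sinhSqCoeff N * x ^ (N - 1) : ℝ) : ℂ) * z ^ N)
      (Complex.sinh ((x : ℂ) * z) ^ 2 / (x : ℂ)) := by
  refine ((hasSum_sinh_sq ((x : ℂ) * z)).div_const (x : ℂ)).congr_fun fun N => ?_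
  rcases N with _ | _ | N
  · simp [sinhSqCoeff_zero]
  · simp [sinhSqCoeff_one]
  · rcases eq_or_ne x 0 with rfl | hx
    · simp
    · have : (x : ℂ) ≠ 0 := by exact_mod_cast hx
      push_cast
      rw [mul_pow, pow_succ (x : ℂ) (N + 1)]
      field_simp

lemma isCoeffFamily_sinh_sq_div (k : Fin n') :
    IsCoeffFamily (r := r) (fun p z => Complex.sinh ((p.2 k : ℂ) * z) ^ 2 / (p.2 k : ℂ)) 1
      (fun p N => sinhSqCoeff N * p.2 k ^ (N - 1)) where
  cont N := by fun_prop
  nonneg p hp N := mul_nonneg (sinhSqCoeff_nonneg N) (pow_nonneg (hp.2 k) _)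
  homog t _ p N := by
    rcases N with _ | N
    · simp [sinhSqCoeff_zero]
    · simp only [Prod.smul_snd, Pi.smul_apply, smul_eq_mul, Nat.add_sub_cancel, mul_pow]
      ring
  hasPS p R z _ := hasSum_sinh_sq_div _ _

/-- The integrand of `varphi`. -/
def integrand (n' : ℕ) (a : ArcDatum n r) (p : (Fin r → ℝ) × (Fin n' → ℝ)) (z : ℂ) : ℂ :=
  (∏ j, Complex.sinh ((bdry a p.1 j : ℂ) * z)) *
    ∏ k, Complex.sinh ((p.2 k : ℂ) * z) ^ 2 / (p.2 k : ℂ)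

lemma exists_isCoeffFamily_integrand (n' : ℕ) (a : ArcDatum n r) :
    ∃ P, IsCoeffFamily (integrand n' a) n' P := by
  obtain ⟨P, hP⟩ := exists_isCoeffFamily_prod Finset.univ
    (fun j => ⟨_, isCoeffFamily_sinh (n' := n') a j⟩)
  obtain ⟨Q, hQ⟩ := exists_isCoeffFamily_prod Finset.univ
    (fun k => ⟨_, isCoeffFamily_sinh_sq_div (r := r) (n' := n') k⟩)
  have := hP.mul hQ
  rw [mul_zero, zero_add, mul_one, Finset.card_univ, Fintype.card_fin] at this
  exact ⟨_, this⟩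

/-- The linear form `∑ ι_i x_i + ∑ x'_k`. -/
def linForm (a : ArcDatum n r) (p : (Fin r → ℝ) × (Fin n' → ℝ)) : ℝ :=
  ∑ i, (a.ι i : ℝ) * p.1 i + ∑ k, p.2 k

lemma continuous_linForm (a : ArcDatum n r) : Continuous (linForm (n' := n') a) := by
  unfold linForm; fun_prop

lemma linForm_nonneg (a : ArcDatum n r) {p : (Fin r → ℝ) × (Fin n' → ℝ)} (hp : p ∈ orthant r n') :
    0 ≤ linForm a p :=
  add_nonneg (Finset.sum_nonneg fun i _ => mul_nonneg (Nat.cast_nonneg _) (hp.1 i))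
    (Finset.sum_nonneg fun k _ => hp.2 k)

lemma linForm_smul (a : ArcDatum n r) (t : ℝ) (p : (Fin r → ℝ) × (Fin n' → ℝ)) :
    linForm a (t • p) = t * linForm a p := by
  simp only [linForm, Prod.smul_fst, Prod.smul_snd, Pi.smul_apply, smul_eq_mul, mul_add,
    Finset.mul_sum]
  congr 1
  exact Finset.sum_congr rfl fun i _ => by ring

lemma isClosed_orthant (r n' : ℕ) : IsClosed (orthant r n') := by
  have : orthant r n' = (⋂ i, {p | 0 ≤ p.1 i}) ∩ ⋂ k, {p | 0 ≤ p.2 k} := by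
    ext p; simp [orthant]
  rw [this]
  exact (isClosed_iInter fun i => isClosed_le continuous_const (by fun_prop)).inter
    (isClosed_iInter fun k => isClosed_le continuous_const (by fun_prop))

lemma measurableSet_orthant (r n' : ℕ) : MeasurableSet (orthant r n') :=
  (isClosed_orthant r n').measurableSet

lemma simplex_eq (a : ArcDatum n r) :
    simplex n' a = orthant r n' ∩ {p | linForm a p ≤ 1} := by
  ext p; simp [simplex, orthant, linForm, and_assoc]

lemma measurableSet_simplex (a : ArcDatum n r) : MeasurableSet (simplex n' a) := by
  rw [simplex_eq]
  exact (measurableSet_orthant r n').inter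
    (isClosed_le (continuous_linForm a) continuous_const).measurableSet

lemma smul_mem_orthant {t : ℝ} (ht : 0 < t) {p : (Fin r → ℝ) × (Fin n' → ℝ)} :
    t • p ∈ orthant r n' ↔ p ∈ orthant r n' := by
  simp [orthant, mul_nonneg_iff_of_pos_left ht]

open ENNReal in
lemma lintegral_comp_smul_pos (G : (Fin r → ℝ) × (Fin n' → ℝ) → ℝ≥0∞) (hG : Measurable G) {t : ℝ}
    (ht : 0 < t) : ∫⁻ p, G p = ENNReal.ofReal (t ^ (r + n')) * ∫⁻ p, G (t • p) := by
  have h1 : ∫⁻ p, G (t • p) = ∫⁻ p, G p ∂(Measure.map (t • ·) volume) :=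
    (lintegral_map hG (measurable_const_smul t)).symm
  have : (volume : Measure ((Fin r → ℝ) × (Fin n' → ℝ))).IsAddHaarMeasure :=
    Measure.prod.instIsAddHaarMeasure _ _
  rw [h1, Measure.map_addHaar_smul volume ht.ne', lintegral_smul_measure, smul_eq_mul, ← mul_assoc,
    ← ENNReal.ofReal_mul (by positivity), abs_of_pos (by positivity)]
  have : Module.finrank ℝ ((Fin r → ℝ) × (Fin n' → ℝ)) = r + n' := by simp
  rw [this, mul_inv_cancel₀ (by positivity)]
  simp

open ENNReal in
lemma setLIntegral_exp_neg {l : ℝ} (hl : 0 ≤ l) :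
    ∫⁻ t in Set.Ioi 0, (Set.Ici l).indicator (fun t => ENNReal.ofReal (Real.exp (-t))) t =
      ENNReal.ofReal (Real.exp (-l)) := by
  rw [lintegral_indicator measurableSet_Ici, Measure.restrict_restrict measurableSet_Ici]
  have h1 : (Set.Ici l ∩ Set.Ioi 0 : Set ℝ) =ᵐ[volume] Set.Ioi l := by
    have h2 : (Set.Ici l ∩ Set.Ioi 0 : Set ℝ) =ᵐ[volume] (Set.Ioi l ∩ Set.Ioi 0 : Set ℝ) :=
      Ioi_ae_eq_Ici.symm.inter (ae_eq_refl _)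
    rwa [Set.Ioi_inter_Ioi, max_eq_left hl] at h2
  rw [Measure.restrict_congr_set h1, ← integral_exp_neg_Ioi,
    ofReal_integral_eq_lintegral_ofReal]
  · exact integrableOn_exp_neg_Ioi l
  · exact Eventually.of_forall fun t => (Real.exp_pos _).le

open ENNReal in
lemma setLIntegral_pow_mul_exp_neg (m : ℕ) :
    ∫⁻ t in Set.Ioi (0 : ℝ), ENNReal.ofReal (t ^ m * Real.exp (-t)) =
      ENNReal.ofReal (m.factorial : ℝ) := by
  have h1 := Real.GammaIntegral_convergent (s := m + 1) (by positivity)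
  rw [← Real.Gamma_nat_eq_factorial, Real.Gamma_eq_integral (by positivity),
    ofReal_integral_eq_lintegral_ofReal h1]
  · refine setLIntegral_congr_fun measurableSet_Ioi fun t ht => ?_
    rw [add_sub_cancel_right, Real.rpow_natCast, mul_comm]
  · filter_upwards [ae_restrict_mem measurableSet_Ioi] with t ht
    have : (0 : ℝ) < t := ht
    positivity

open ENNReal in
/-- Laplace transform of a homogeneous function, in terms of its integral over the simplex. -/
lemma lintegral_homogeneous_mul_exp_neg (a : ArcDatum n r)
    {F : (Fin r → ℝ) × (Fin n' → ℝ) → ℝ} (hF : Measurable F) {N : ℕ}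
    (hhom : ∀ t : ℝ, 0 < t → ∀ p, t ^ n' * F (t • p) = t ^ N * F p) :
    ∫⁻ p in orthant r n', ENNReal.ofReal (F p) * ENNReal.ofReal (Real.exp (-linForm a p)) =
      ENNReal.ofReal ((N + r).factorial : ℝ) * ∫⁻ p in simplex n' a, ENNReal.ofReal (F p) := by
  have hmF : Measurable fun p => ENNReal.ofReal (F p) := hF.ennreal_ofReal
  have hml : Measurable (linForm (n' := n') a) := (continuous_linForm a).measurable
  set Φ : (Fin r → ℝ) × (Fin n' → ℝ) → ℝ → ℝ≥0∞ := fun p t =>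
    ENNReal.ofReal (F p) * (Set.Ici (linForm a p)).indicator
      (fun t => ENNReal.ofReal (Real.exp (-t))) t with hΦ
  have h1 : ∫⁻ p in orthant r n', ENNReal.ofReal (F p) * ENNReal.ofReal (Real.exp (-linForm a p)) =
      ∫⁻ p in orthant r n', ∫⁻ t in Set.Ioi 0, Φ p t := by
    refine setLIntegral_congr_fun (measurableSet_orthant r n') fun p hp => ?_
    simp only [hΦ]
    rw [lintegral_const_mul _ ((by fun_prop : Measurable fun t : ℝ =>
      ENNReal.ofReal (Real.exp (-t))).indicator measurableSet_Ici),
      setLIntegral_exp_neg (linForm_nonneg a hp)]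
  have hset : MeasurableSet {q : ((Fin r → ℝ) × (Fin n' → ℝ)) × ℝ | linForm a q.1 ≤ q.2} :=
    measurableSet_le (hml.comp measurable_fst) measurable_snd
  have hmeas : Measurable (Function.uncurry Φ) := by
    have : Function.uncurry Φ = fun q => ENNReal.ofReal (F q.1) *
        {q : ((Fin r → ℝ) × (Fin n' → ℝ)) × ℝ | linForm a q.1 ≤ q.2}.indicator
          (fun q => ENNReal.ofReal (Real.exp (-q.2))) q := by
      ext q; rfl
    rw [this]
    exact (hmF.comp measurable_fst).mul ((by fun_prop : Measurable
      fun q : ((Fin r → ℝ) × (Fin n' → ℝ)) × ℝ => ENNReal.ofReal (Real.exp (-q.2))).indicator hset)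
  rw [h1, lintegral_lintegral_swap hmeas.aemeasurable]
  have h2 : ∀ t ∈ Set.Ioi (0 : ℝ), ∫⁻ p in orthant r n', Φ p t =
      ENNReal.ofReal (t ^ (N + r) * Real.exp (-t)) *
        ∫⁻ p in simplex n' a, ENNReal.ofReal (F p) := by
    intro t ht
    have ht : 0 < t := ht
    have e1 : ∫⁻ p in orthant r n', Φ p t = ENNReal.ofReal (Real.exp (-t)) *
        ∫⁻ p, (orthant r n' ∩ {p | linForm a p ≤ t}).indicator
          (fun p => ENNReal.ofReal (F p)) p := by
      rw [← lintegral_const_mul _ (hmF.indicator ((measurableSet_orthant r n').inter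
        (measurableSet_le hml measurable_const))), ← lintegral_indicator (measurableSet_orthant r n')]
      refine lintegral_congr fun p => ?_
      by_cases hp : p ∈ orthant r n' <;> by_cases hp' : linForm a p ≤ t <;>
        simp [hΦ, hp, hp', mul_comm]
    have e2 : ∫⁻ p, (orthant r n' ∩ {p | linForm a p ≤ t}).indicator
          (fun p => ENNReal.ofReal (F p)) (t • p) =
        ENNReal.ofReal (t ^ N / t ^ n') * ∫⁻ p in simplex n' a, ENNReal.ofReal (F p) := by
      rw [← lintegral_indicator (measurableSet_simplex a),
        ← lintegral_const_mul _ (hmF.indicator (measurableSet_simplex a))]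
      refine lintegral_congr fun p => ?_
      have e3 : t • p ∈ orthant r n' ∩ {p | linForm a p ≤ t} ↔ p ∈ simplex n' a := by
        rw [simplex_eq, Set.mem_inter_iff, Set.mem_inter_iff, smul_mem_orthant ht,
          Set.mem_ofPred_eq, Set.mem_ofPred_eq, linForm_smul, mul_le_iff_le_one_right ht]
      have e4 : F (t • p) = t ^ N / t ^ n' * F p := by
        have := hhom t ht p
        field_simp
        linarith
      by_cases hp : p ∈ simplex n' a
      · rw [Set.indicator_of_mem (e3.2 hp), Set.indicator_of_mem hp, e4,
          ENNReal.ofReal_mul (by positivity)]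
      · rw [Set.indicator_of_notMem (e3.not.2 hp), Set.indicator_of_notMem hp, mul_zero]
    rw [e1, lintegral_comp_smul_pos _ (hmF.indicator ((measurableSet_orthant r n').inter
        (measurableSet_le hml measurable_const))) ht, e2, ← mul_assoc, ← mul_assoc,
      ← ENNReal.ofReal_mul (by positivity), ← ENNReal.ofReal_mul (by positivity)]
    congr 2
    rw [pow_add, pow_add]
    field_simp
  rw [setLIntegral_congr_fun measurableSet_Ioi h2, lintegral_mul_const _ (by fun_prop),
    setLIntegral_pow_mul_exp_neg]

end ArcAsymptotics

namespace ArcAsymptotics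

variable {n r n' : ℕ}

lemma integrable_of_summable_integral_norm {α : Type*} [MeasurableSpace α] {μ : Measure α}
    {F : ℕ → α → ℂ} {f : α → ℂ} (hf : AEStronglyMeasurable f μ) (hF : ∀ i, Integrable (F i) μ)
    (hsum : Summable fun i => ∫ a, ‖F i a‖ ∂μ) (h : ∀ᵐ a ∂μ, HasSum (fun i => F i a) (f a)) :
    Integrable f μ := by
  refine ⟨hf, ?_⟩
  have h1 : ∫⁻ a, ‖f a‖ₑ ∂μ ≤ ∫⁻ a, ∑' i, ‖F i a‖ₑ ∂μ := by
    refine lintegral_mono_ae ?_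
    filter_upwards [h] with a ha
    rw [← ha.tsum_eq]
    exact enorm_tsum_le_tsum_enorm
  refine h1.trans_lt ?_
  rw [lintegral_tsum fun i => (hF i).1.enorm]
  simp only [← fun i => ofReal_integral_norm_eq_lintegral_enorm (hF i)]
  exact hsum.tsum_ofReal_lt_top

/-- Lebesgue measure on the half-line `[0, ∞)`. -/
def halfLine : Measure ℝ := volume.restrict (Set.Ici 0)

instance : SigmaFinite halfLine := by unfold halfLine; infer_instance

lemma restrict_orthant : (volume : Measure ((Fin r → ℝ) × (Fin n' → ℝ))).restrict (orthant r n') =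
    (Measure.pi fun _ : Fin r => halfLine).prod (Measure.pi fun _ : Fin n' => halfLine) := by
  have : orthant r n' = (Set.univ.pi fun _ => Set.Ici 0) ×ˢ (Set.univ.pi fun _ => Set.Ici 0) := by
    ext p
    simp only [orthant, Set.mem_prod, Set.mem_pi, Set.mem_univ, forall_true_left, Set.mem_Ici,
      Set.mem_ofPred_eq]
  rw [this, Measure.volume_eq_prod, ← Measure.prod_restrict, volume_pi, volume_pi,
    Measure.restrict_pi_pi, Measure.restrict_pi_pi]
  rfl

lemma integrable_exp_halfLine {w : ℂ} (hw : 0 < w.re) :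
    Integrable (fun x : ℝ => Complex.exp (-(w * x))) halfLine := by
  have := integrableOn_exp_mul_complex_Ioi (a := -w) (by simpa using hw) 0
  rw [← integrableOn_Ici_iff_integrableOn_Ioi] at this
  simpa [neg_mul, IntegrableOn, halfLine] using this

lemma integral_exp_halfLine {w : ℂ} (hw : 0 < w.re) :
    ∫ x : ℝ, Complex.exp (-(w * x)) ∂halfLine = 1 / w := by
  have := integral_exp_mul_complex_Ioi (a := -w) (by simpa using hw) 0
  rw [← integral_Ici_eq_integral_Ioi] at this
  simpa [neg_mul, neg_div_neg_eq, halfLine] using this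

lemma integrable_pow_mul_exp_halfLine (m : ℕ) :
    Integrable (fun x : ℝ => x ^ m * Real.exp (-x)) halfLine := by
  have h := Real.GammaIntegral_convergent (s := m + 1) (by positivity)
  have h2 : IntegrableOn (fun x : ℝ => x ^ m * Real.exp (-x)) (Set.Ioi 0) := by
    refine h.congr_fun (fun x _ => ?_) measurableSet_Ioi
    dsimp only
    rw [add_sub_cancel_right, Real.rpow_natCast, mul_comm]
  rwa [← integrableOn_Ici_iff_integrableOn_Ioi] at h2

lemma integral_pow_mul_exp_halfLine (m : ℕ) :
    ∫ x : ℝ, x ^ m * Real.exp (-x) ∂halfLine = m.factorial := by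
  rw [halfLine, integral_Ici_eq_integral_Ioi, ← Real.Gamma_nat_eq_factorial,
    Real.Gamma_eq_integral (by positivity)]
  refine setIntegral_congr_fun measurableSet_Ioi fun x _ => ?_
  rw [add_sub_cancel_right, Real.rpow_natCast, mul_comm]

lemma log_one_sub_four_mul_sq {z : ℂ} (hz : ‖z‖ < 1 / 2) :
    Complex.log (1 - 2 * z) + Complex.log (1 - -2 * z) = Complex.log (1 - 4 * z ^ 2) := by
  have hre : |z.re| < 1 / 2 := (Complex.abs_re_le_norm z).trans_lt hz
  rw [abs_lt] at hre
  have h1 : 0 < (1 - 2 * z).re := by simp; linarith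
  have h2 : 0 < (1 - -2 * z).re := by simp; linarith
  have a1 := Complex.abs_arg_lt_pi_div_two_iff.2 (Or.inl h1)
  have a2 := Complex.abs_arg_lt_pi_div_two_iff.2 (Or.inl h2)
  rw [abs_lt] at a1 a2
  rw [← (Complex.log_mul_eq_add_log_iff (fun h => by rw [h] at h1; simp at h1)
    (fun h => by rw [h] at h2; simp at h2)).2 ⟨by linarith, by linarith⟩]
  congr 1; ring

/-- The Laplace transform of `sinh(x z)² / x`. -/
def sinhLog (z : ℂ) : ℂ := 1 / 4 * -Complex.log (1 - 4 * z ^ 2)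

lemma hasPS_sinhLog :
    HasPS (1 / 2) sinhLog fun N => ((sinhSqCoeff N * (N - 1).factorial : ℝ) : ℂ) := by
  intro z hz
  have hz2 : ‖2 * z‖ < 1 := by rw [norm_mul]; norm_num; linarith
  have hz2' : ‖-2 * z‖ < 1 := by rw [norm_mul]; norm_num; linarith
  have h := ((Complex.hasSum_taylorSeries_neg_log hz2).add
    (Complex.hasSum_taylorSeries_neg_log hz2')).mul_left (1 / 4)
  rw [← neg_add, log_one_sub_four_mul_sq hz] at h
  refine h.congr_fun fun N => ?_
  rcases N with _ | N
  · simp [sinhSqCoeff_zero]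
  · have e : sinhSqCoeff (N + 1) = (2 ^ (N + 1) + (-2) ^ (N + 1)) / (4 * (N + 1).factorial) := by
      simp [sinhSqCoeff]
    dsimp only
    rw [e, Nat.add_sub_cancel, Nat.factorial_succ, mul_pow, mul_pow]
    have : (N.factorial : ℂ) ≠ 0 := by exact_mod_cast N.factorial_ne_zero
    have : (N + 1 : ℂ) ≠ 0 := by exact_mod_cast N.succ_ne_zero
    push_cast
    field_simp

/-- The terms of the expansion of `e^{-x} sinh(x z)² / x`. -/
lemma integrable_sinh_sq_term (z : ℂ) (N : ℕ) :
    Integrable (fun x : ℝ => ((sinhSqCoeff N * x ^ (N - 1) : ℝ) : ℂ) * z ^ N *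
      (Real.exp (-x) : ℂ)) halfLine := by
  refine (((integrable_pow_mul_exp_halfLine (N - 1)).ofReal (𝕜 := ℂ)).const_mul
    (sinhSqCoeff N * z ^ N)).congr (Eventually.of_forall fun x => ?_)
  simp
  ring

lemma integral_sinh_sq_term (z : ℂ) (N : ℕ) :
    ∫ x : ℝ, ((sinhSqCoeff N * x ^ (N - 1) : ℝ) : ℂ) * z ^ N * (Real.exp (-x) : ℂ) ∂halfLine =
      ((sinhSqCoeff N * (N - 1).factorial : ℝ) : ℂ) * z ^ N := by
  have h1 : ∀ x : ℝ, ((sinhSqCoeff N * x ^ (N - 1) : ℝ) : ℂ) * z ^ N * (Real.exp (-x) : ℂ) =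
      (sinhSqCoeff N * z ^ N) * ((x ^ (N - 1) * Real.exp (-x) : ℝ) : ℂ) := fun x => by
    push_cast; ring
  simp only [h1]
  rw [integral_const_mul, integral_complex_ofReal, integral_pow_mul_exp_halfLine]
  push_cast; ring

lemma norm_sinh_sq_term (z : ℂ) (N : ℕ) {x : ℝ} (hx : 0 ≤ x) :
    ‖((sinhSqCoeff N * x ^ (N - 1) : ℝ) : ℂ) * z ^ N * (Real.exp (-x) : ℂ)‖ =
      sinhSqCoeff N * ‖z‖ ^ N * (x ^ (N - 1) * Real.exp (-x)) := by
  rw [norm_mul, norm_mul, Complex.norm_real, Complex.norm_real, norm_pow,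
    Real.norm_of_nonneg (mul_nonneg (sinhSqCoeff_nonneg N) (by positivity)),
    Real.norm_of_nonneg (Real.exp_pos _).le]
  ring

lemma ae_halfLine_nonneg : ∀ᵐ x ∂halfLine, 0 ≤ x := ae_restrict_mem measurableSet_Ici

lemma summable_integral_norm_sinh_sq_term {z : ℂ} (hz : ‖z‖ < 1 / 2) :
    Summable fun N => ∫ x : ℝ, ‖((sinhSqCoeff N * x ^ (N - 1) : ℝ) : ℂ) * z ^ N *
      (Real.exp (-x) : ℂ)‖ ∂halfLine := by
  refine (hasPS_sinhLog.summable_norm (norm_nonneg z) hz).congr fun N => ?_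
  rw [integral_congr_ae (ae_halfLine_nonneg.mono fun x hx => norm_sinh_sq_term z N hx),
    integral_const_mul, integral_pow_mul_exp_halfLine, Complex.norm_real,
    Real.norm_of_nonneg (mul_nonneg (sinhSqCoeff_nonneg N) (by positivity))]
  ring

lemma hasSum_sinh_sq_term (z : ℂ) (x : ℝ) :
    HasSum (fun N => ((sinhSqCoeff N * x ^ (N - 1) : ℝ) : ℂ) * z ^ N * (Real.exp (-x) : ℂ))
      (Complex.sinh ((x : ℂ) * z) ^ 2 / (x : ℂ) * (Real.exp (-x) : ℂ)) :=
  (hasSum_sinh_sq_div x z).mul_right _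

lemma integrable_sinh_sq_div {z : ℂ} (hz : ‖z‖ < 1 / 2) :
    Integrable (fun x : ℝ => Complex.sinh ((x : ℂ) * z) ^ 2 / (x : ℂ) * (Real.exp (-x) : ℂ))
      halfLine := by
  refine integrable_of_summable_integral_norm (Measurable.aestronglyMeasurable ?_)
    (integrable_sinh_sq_term z) (summable_integral_norm_sinh_sq_term hz)
    (Eventually.of_forall fun x => hasSum_sinh_sq_term z x)
  have h1 : Measurable fun x : ℝ => Complex.sinh ((x : ℂ) * z) :=
    (Complex.continuous_sinh.comp (by fun_prop)).measurable
  exact ((h1.pow_const 2).div Complex.measurable_ofReal).mul (by fun_prop)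

lemma integral_sinh_sq_div {z : ℂ} (hz : ‖z‖ < 1 / 2) :
    ∫ x : ℝ, Complex.sinh ((x : ℂ) * z) ^ 2 / (x : ℂ) * (Real.exp (-x) : ℂ) ∂halfLine =
      sinhLog z := by
  have h := hasSum_integral_of_summable_integral_norm (integrable_sinh_sq_term z)
    (summable_integral_norm_sinh_sq_term hz)
  simp only [integral_sinh_sq_term, (hasSum_sinh_sq_term z _).tsum_eq] at h
  exact h.unique (hasPS_sinhLog z hz)

lemma sinh_eq_sum_units (w : ℂ) :
    Complex.sinh w = ∑ u : ℤˣ, ((u : ℤ) : ℂ) / 2 * Complex.exp (((u : ℤ) : ℂ) * w) := by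
  rw [show (Finset.univ : Finset ℤˣ) = {1, -1} from rfl, Finset.sum_pair (by decide),
    Complex.sinh]
  simp
  ring

lemma sum_signs_mul_bdry (a : ArcDatum n r) (ε : Fin n → ℤˣ) (x : Fin r → ℝ) (z : ℂ) :
    ∑ j, ((ε j : ℤ) : ℂ) * ((bdry a x j : ℂ) * z) = ∑ i, (signedSum a ε i : ℂ) * z * x i := by
  simp only [bdry, signedSum]
  push_cast
  simp only [Finset.sum_mul, Finset.mul_sum]
  rw [Finset.sum_comm]
  exact Finset.sum_congr rfl fun i _ => Finset.sum_congr rfl fun j _ => by ring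

lemma prod_sinh_bdry (a : ArcDatum n r) (x : Fin r → ℝ) (z : ℂ) :
    ∏ j, Complex.sinh ((bdry a x j : ℂ) * z) = ∑ ε : Fin n → ℤˣ,
      ((∏ j, ((ε j : ℤ) : ℂ)) / 2 ^ n) * ∏ i, Complex.exp ((signedSum a ε i : ℂ) * z * x i) := by
  simp only [sinh_eq_sum_units, Finset.prod_univ_sum, Fintype.piFinset_univ]
  refine Finset.sum_congr rfl fun ε _ => ?_
  rw [Finset.prod_mul_distrib, Finset.prod_div_distrib, ← Complex.exp_sum, ← Complex.exp_sum,
    sum_signs_mul_bdry]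
  simp

lemma integrand_mul_exp (a : ArcDatum n r) (p : (Fin r → ℝ) × (Fin n' → ℝ)) (z : ℂ) :
    integrand n' a p z * (Real.exp (-linForm a p) : ℂ) = ∑ ε : Fin n → ℤˣ,
      ((∏ j, ((ε j : ℤ) : ℂ)) / 2 ^ n) *
        ((∏ i, Complex.exp (-(((a.ι i : ℂ) - (signedSum a ε i : ℂ) * z) * p.1 i))) *
          ∏ k, (Complex.sinh ((p.2 k : ℂ) * z) ^ 2 / (p.2 k : ℂ) * (Real.exp (-p.2 k) : ℂ))) := by
  have h1 : (Real.exp (-linForm a p) : ℂ) =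
      (∏ i, Complex.exp (-((a.ι i : ℂ) * p.1 i))) * ∏ k, (Real.exp (-p.2 k) : ℂ) := by
    push_cast
    rw [← Complex.exp_sum, ← Complex.exp_sum, ← Complex.exp_add, linForm]
    push_cast
    rw [neg_add, Finset.sum_neg_distrib, Finset.sum_neg_distrib]
  rw [integrand, prod_sinh_bdry, h1, Finset.sum_mul, Finset.sum_mul]
  refine Finset.sum_congr rfl fun ε _ => ?_
  have h2 : ∏ i, Complex.exp (-(((a.ι i : ℂ) - (signedSum a ε i : ℂ) * z) * p.1 i)) =
      (∏ i, Complex.exp ((signedSum a ε i : ℂ) * z * p.1 i)) *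
        ∏ i, Complex.exp (-((a.ι i : ℂ) * p.1 i)) := by
    rw [← Finset.prod_mul_distrib]
    refine Finset.prod_congr rfl fun i _ => ?_
    rw [← Complex.exp_add]; congr 1; ring
  rw [h2, Finset.prod_mul_distrib (s := (Finset.univ : Finset (Fin n')))]
  ring

lemma norm_signedSum_le (a : ArcDatum n r) (ε : Fin n → ℤˣ) (i : Fin r) :
    ‖(signedSum a ε i : ℂ)‖ ≤ 2 := by
  rcases signedSum_cases a ε i with h | h | h <;> rw [h] <;> norm_num

lemma re_iota_sub_pos (a : ArcDatum n r) (ε : Fin n → ℤˣ) (i : Fin r) {z : ℂ}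
    (hz : ‖z‖ < 1 / 2) : 0 < ((a.ι i : ℂ) - (signedSum a ε i : ℂ) * z).re := by
  have h1 : ‖(signedSum a ε i : ℂ) * z‖ ≤ 2 * ‖z‖ := by
    rw [norm_mul]
    exact mul_le_mul_of_nonneg_right (norm_signedSum_le a ε i) (norm_nonneg z)
  have h2 := (Complex.re_le_norm ((signedSum a ε i : ℂ) * z)).trans h1
  have h3 : (1 : ℝ) ≤ a.ι i := by exact_mod_cast a.ι_pos i
  rw [Complex.sub_re, Complex.natCast_re]
  linarith

lemma phiTerm_eq (a : ArcDatum n r) (z : ℂ) :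
    phiTerm a z = ∑ ε : Fin n → ℤˣ, (∏ j, ((ε j : ℤ) : ℂ)) *
      ∏ i, 1 / ((a.ι i : ℂ) - (signedSum a ε i : ℂ) * z) := by
  simp [phiTerm, signedSum]

lemma integrable_integrand_term (a : ArcDatum n r) (ε : Fin n → ℤˣ) {z : ℂ} (hz : ‖z‖ < 1 / 2) :
    Integrable (fun p : (Fin r → ℝ) × (Fin n' → ℝ) =>
      (∏ i, Complex.exp (-(((a.ι i : ℂ) - (signedSum a ε i : ℂ) * z) * p.1 i))) *
        ∏ k, (Complex.sinh ((p.2 k : ℂ) * z) ^ 2 / (p.2 k : ℂ) * (Real.exp (-p.2 k) : ℂ)))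
      (volume.restrict (orthant r n')) := by
  rw [restrict_orthant]
  exact (Integrable.fintype_prod (f := fun (i : Fin r) (x : ℝ) =>
      Complex.exp (-(((a.ι i : ℂ) - (signedSum a ε i : ℂ) * z) * x)))
      fun i => integrable_exp_halfLine (re_iota_sub_pos a ε i hz)).mul_prod
    (Integrable.fintype_prod (f := fun (_ : Fin n') (x : ℝ) =>
      Complex.sinh ((x : ℂ) * z) ^ 2 / (x : ℂ) * (Real.exp (-x) : ℂ))
      fun _ => integrable_sinh_sq_div hz)

lemma integrable_integrand_mul_exp (n' : ℕ) (a : ArcDatum n r) {z : ℂ} (hz : ‖z‖ < 1 / 2) :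
    Integrable (fun p => integrand n' a p z * (Real.exp (-linForm a p) : ℂ))
      (volume.restrict (orthant r n')) := by
  simp only [integrand_mul_exp]
  exact integrable_finsetSum _ fun ε _ => (integrable_integrand_term a ε hz).const_mul _

lemma integral_integrand_mul_exp (n' : ℕ) (a : ArcDatum n r) {z : ℂ} (hz : ‖z‖ < 1 / 2) :
    ∫ p in orthant r n', integrand n' a p z * (Real.exp (-linForm a p) : ℂ) =
      phiTerm a z / 2 ^ n * sinhLog z ^ n' := by
  simp only [integrand_mul_exp]
  rw [integral_finsetSum _ fun ε _ => (integrable_integrand_term a ε hz).const_mul _, phiTerm_eq,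
    Finset.sum_div, Finset.sum_mul]
  refine Finset.sum_congr rfl fun ε _ => ?_
  rw [integral_const_mul, restrict_orthant, integral_prod_mul
    (fun x : Fin r → ℝ => ∏ i, Complex.exp (-(((a.ι i : ℂ) - (signedSum a ε i : ℂ) * z) * x i)))
    (fun x : Fin n' → ℝ => ∏ k, (Complex.sinh ((x k : ℂ) * z) ^ 2 / (x k : ℂ) *
      (Real.exp (-x k) : ℂ))),
    integral_fintype_prod_eq_prod (fun (i : Fin r) (x : ℝ) =>
      Complex.exp (-(((a.ι i : ℂ) - (signedSum a ε i : ℂ) * z) * x))),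
    integral_fintype_prod_eq_prod (fun (_ : Fin n') (x : ℝ) =>
      Complex.sinh ((x : ℂ) * z) ^ 2 / (x : ℂ) * (Real.exp (-x) : ℂ))]
  simp only [integral_sinh_sq_div hz, Finset.prod_const, Finset.card_univ, Fintype.card_fin]
  rw [Finset.prod_congr rfl fun i _ => integral_exp_halfLine (re_iota_sub_pos a ε i hz)]
  ring

end ArcAsymptotics

namespace ArcAsymptotics

variable {n r n' : ℕ}

namespace IsCoeffFamily

variable {g : (Fin r → ℝ) × (Fin n' → ℝ) → ℂ → ℂ} {e : ℕ}
  {P : (Fin r → ℝ) × (Fin n' → ℝ) → ℕ → ℝ}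

lemma norm_term (h : IsCoeffFamily g e P) {p : (Fin r → ℝ) × (Fin n' → ℝ)}
    (hp : p ∈ orthant r n') (z : ℂ) (N : ℕ) : ‖(P p N : ℂ) * z ^ N‖ = P p N * ‖z‖ ^ N := by
  rw [norm_mul, norm_pow, Complex.norm_real, Real.norm_of_nonneg (h.nonneg p hp N)]

lemma sum_le_norm (h : IsCoeffFamily g e P) {p : (Fin r → ℝ) × (Fin n' → ℝ)}
    (hp : p ∈ orthant r n') {u : ℝ} (hu : 0 ≤ u) (s : Finset ℕ) :
    ∑ N ∈ s, P p N * u ^ N ≤ ‖g p u‖ := by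
  have h1 := h.hasPS p (‖(u : ℂ)‖ + 1) u (by linarith)
  have h2 : HasSum (fun N => P p N * u ^ N) (g p u).re := by
    have := Complex.hasSum_re h1
    refine this.congr_fun fun N => ?_
    rw [← Complex.ofReal_pow, ← Complex.ofReal_mul, Complex.ofReal_re]
  refine (sum_le_hasSum s (fun N _ => mul_nonneg (h.nonneg p hp N) (by positivity)) h2).trans ?_
  exact Complex.re_le_norm _

lemma le_norm (h : IsCoeffFamily g e P) {p : (Fin r → ℝ) × (Fin n' → ℝ)}
    (hp : p ∈ orthant r n') {u : ℝ} (hu : 0 ≤ u) (N : ℕ) : P p N * u ^ N ≤ ‖g p u‖ := by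
  simpa using h.sum_le_norm hp hu {N}

end IsCoeffFamily

variable {P : (Fin r → ℝ) × (Fin n' → ℝ) → ℕ → ℝ}

lemma integrable_coeff_mul_exp (a : ArcDatum n r) (hP : IsCoeffFamily (integrand n' a) n' P)
    (N : ℕ) : Integrable (fun p => P p N * Real.exp (-linForm a p))
      (volume.restrict (orthant r n')) := by
  have h1 := (integrable_integrand_mul_exp n' a (z := ((1 / 4 : ℝ) : ℂ))
    (by rw [Complex.norm_real]; norm_num)).norm.const_mul (4 ^ N)
  refine h1.mono' (((hP.cont N).mul
    (Real.continuous_exp.comp (continuous_linForm a).neg)).aestronglyMeasurable) ?_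
  filter_upwards [ae_restrict_mem (measurableSet_orthant r n')] with p hp
  have h2 := hP.le_norm hp (u := 1 / 4) (by norm_num) N
  have h3 : P p N ≤ 4 ^ N * ‖integrand n' a p ((1 / 4 : ℝ) : ℂ)‖ := by
    have h4 : P p N = 4 ^ N * (P p N * (1 / 4) ^ N) := by
      rw [one_div, inv_pow]; field_simp
    rw [h4]; gcongr
  rw [norm_mul, norm_mul, Complex.norm_real, Real.norm_of_nonneg (hP.nonneg p hp N),
    Real.norm_of_nonneg (Real.exp_pos _).le, ← mul_assoc]
  gcongr

lemma hasPS_integral_coeff_mul_exp (a : ArcDatum n r)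
    (hP : IsCoeffFamily (integrand n' a) n' P) :
    HasPS (1 / 2) (fun z => phiTerm a z / 2 ^ n * sinhLog z ^ n') fun N =>
      ((∫ p in orthant r n', P p N * Real.exp (-linForm a p) : ℝ) : ℂ) := by
  intro z hz
  have hint : ∀ N, Integrable (fun p => (P p N : ℂ) * z ^ N * (Real.exp (-linForm a p) : ℂ))
      (volume.restrict (orthant r n')) := fun N => by
    refine (((integrable_coeff_mul_exp a hP N).ofReal (𝕜 := ℂ)).mul_const (z ^ N)).congr
      (Eventually.of_forall fun p => ?_)
    simp
    ring
  have hnorm : ∀ N, ∀ p ∈ orthant r n',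
      ‖(P p N : ℂ) * z ^ N * (Real.exp (-linForm a p) : ℂ)‖ =
        P p N * ‖z‖ ^ N * Real.exp (-linForm a p) := fun N p hp => by
    rw [norm_mul, hP.norm_term hp, Complex.norm_real, Real.norm_of_nonneg (Real.exp_pos _).le]
  have hz' : ‖((‖z‖ : ℝ) : ℂ)‖ < 1 / 2 := by simpa using hz
  have hsum : Summable fun N => ∫ p in orthant r n',
      ‖(P p N : ℂ) * z ^ N * (Real.exp (-linForm a p) : ℂ)‖ := by
    refine summable_of_sum_le (c := ∫ p in orthant r n',
      ‖integrand n' a p ((‖z‖ : ℝ) : ℂ) * (Real.exp (-linForm a p) : ℂ)‖)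
      (fun N => integral_nonneg fun p => norm_nonneg _) fun s => ?_
    rw [← integral_finsetSum _ fun N _ => (hint N).norm]
    refine integral_mono_ae (integrable_finsetSum _ fun N _ => (hint N).norm)
      (integrable_integrand_mul_exp n' a hz').norm ?_
    filter_upwards [ae_restrict_mem (measurableSet_orthant r n')] with p hp
    rw [Finset.sum_congr rfl fun N _ => hnorm N p hp, ← Finset.sum_mul, norm_mul,
      Complex.norm_real, Real.norm_of_nonneg (Real.exp_pos _).le]
    gcongr
    exact hP.sum_le_norm hp (norm_nonneg z) s
  have h := hasSum_integral_of_summable_integral_norm hint hsum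
  have h2 : ∀ p, ∑' N, (P p N : ℂ) * z ^ N * (Real.exp (-linForm a p) : ℂ) =
      integrand n' a p z * (Real.exp (-linForm a p) : ℂ) := fun p =>
    ((hP.hasPS p (‖z‖ + 1) z (by linarith)).mul_right _).tsum_eq
  simp only [h2, integral_integrand_mul_exp n' a hz] at h
  refine h.congr_fun fun N => ?_
  dsimp only
  rw [← integral_complex_ofReal, ← integral_mul_const]
  refine integral_congr_ae (Eventually.of_forall fun p => ?_)
  dsimp only
  push_cast
  ring

lemma integrableOn_coeff_simplex (a : ArcDatum n r) (hP : IsCoeffFamily (integrand n' a) n' P)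
    (N : ℕ) : IntegrableOn (fun p => P p N) (simplex n' a) ∧
      ∫ p in orthant r n', P p N * Real.exp (-linForm a p) =
        ((N + r).factorial : ℝ) * ∫ p in simplex n' a, P p N := by
  have hnnO : ∀ᵐ p ∂(volume.restrict (orthant r n')), 0 ≤ P p N := by
    filter_upwards [ae_restrict_mem (measurableSet_orthant r n')] with p hp
    exact hP.nonneg p hp N
  have hnnS : ∀ᵐ p ∂(volume.restrict (simplex n' a)), 0 ≤ P p N := by
    filter_upwards [ae_restrict_mem (measurableSet_simplex a)] with p hp
    rw [simplex_eq] at hp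
    exact hP.nonneg p hp.1 N
  have hkey := lintegral_homogeneous_mul_exp_neg a (hP.cont N).measurable (N := N)
    (fun t ht p => hP.homog t ht p N)
  have hint := integrable_coeff_mul_exp a hP N
  have h1 : ∫⁻ p in orthant r n', ENNReal.ofReal (P p N) *
      ENNReal.ofReal (Real.exp (-linForm a p)) =
      ENNReal.ofReal (∫ p in orthant r n', P p N * Real.exp (-linForm a p)) := by
    rw [ofReal_integral_eq_lintegral_ofReal hint
      (hnnO.mono fun p hp => mul_nonneg hp (Real.exp_pos _).le)]
    refine lintegral_congr_ae (hnnO.mono fun p hp => ?_)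
    exact (ENNReal.ofReal_mul hp).symm
  rw [h1] at hkey
  have hfac : (0 : ℝ) < (N + r).factorial := by exact_mod_cast (N + r).factorial_pos
  have hfin : ∫⁻ p in simplex n' a, ENNReal.ofReal (P p N) ≠ ⊤ := by
    intro htop
    rw [htop, ENNReal.mul_top (by simpa using (N + r).factorial_ne_zero)] at hkey
    exact ENNReal.ofReal_ne_top hkey
  have hintS : IntegrableOn (fun p => P p N) (simplex n' a) := by
    refine ⟨(hP.cont N).aestronglyMeasurable, ?_⟩
    rw [hasFiniteIntegral_iff_ofReal hnnS]
    exact lt_top_iff_ne_top.2 hfin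
  refine ⟨hintS, ?_⟩
  rw [← ofReal_integral_eq_lintegral_ofReal hintS hnnS, ← ENNReal.ofReal_mul hfac.le] at hkey
  refine (ENNReal.ofReal_eq_ofReal_iff ?_ ?_).1 hkey
  · exact integral_nonneg_of_ae (hnnO.mono fun p hp => mul_nonneg hp (Real.exp_pos _).le)
  · exact mul_nonneg hfac.le (integral_nonneg_of_ae hnnS)

/-- Taylor coefficients of `varphi`, and the closed form of its Borel-type transform. -/
theorem exists_hasPS_varphi (n' : ℕ) (a : ArcDatum n r) :
    ∃ q : ℕ → ℂ, (∀ R, HasPS R (varphi n' a) q) ∧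
      HasPS (1 / 2) (fun z => phiTerm a z / 2 ^ n * sinhLog z ^ n')
        (fun N => ((N + r).factorial : ℂ) * q N) := by
  obtain ⟨P, hP⟩ := exists_isCoeffFamily_integrand n' a
  have hmem : ∀ p ∈ simplex n' a, p ∈ orthant r n' := fun p hp => by
    rw [simplex_eq] at hp; exact hp.1
  set q : ℕ → ℝ := fun N => ∫ p in simplex n' a, P p N with hq
  have hq0 : ∀ N, 0 ≤ q N := fun N =>
    setIntegral_nonneg (measurableSet_simplex a) fun p hp => hP.nonneg p (hmem p hp) N
  have hB := hasPS_integral_coeff_mul_exp a hP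
  simp only [fun N => (integrableOn_coeff_simplex a hP N).2] at hB
  refine ⟨fun N => (q N : ℂ), fun R z _ => ?_, by simpa using hB⟩
  have hqs : Summable fun N => q N * ‖z‖ ^ N := by
    have h1 := hB.summable_norm (ρ := 1 / 4) (by norm_num) (by norm_num)
    set C := ∑' N, ‖((((N + r).factorial : ℝ) * q N : ℝ) : ℂ)‖ * (1 / 4) ^ N
    have h2 : ∀ N, ((N + r).factorial : ℝ) * q N * (1 / 4) ^ N ≤ C := fun N => by
      have := h1.le_tsum N fun j _ => by positivity
      rwa [Complex.norm_real, Real.norm_of_nonneg (mul_nonneg (by positivity) (hq0 N))] at this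
    refine Summable.of_nonneg_of_le (fun N => mul_nonneg (hq0 N) (by positivity)) (fun N => ?_)
      ((Real.summable_pow_div_factorial (4 * ‖z‖)).mul_left C)
    have h3 : (0 : ℝ) < N.factorial := by exact_mod_cast N.factorial_pos
    have h4 : (N.factorial : ℝ) ≤ (N + r).factorial := by
      exact_mod_cast Nat.factorial_le (Nat.le_add_right N r)
    have h5 : (N.factorial : ℝ) * q N * (1 / 4) ^ N ≤ C := by
      refine le_trans ?_ (h2 N)
      have := hq0 N
      gcongr
    rw [← mul_div_assoc, le_div_iff₀ h3]
    calc q N * ‖z‖ ^ N * N.factorial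
        = (N.factorial * q N * (1 / 4) ^ N) * (4 * ‖z‖) ^ N := by
          rw [mul_pow, one_div, inv_pow]; field_simp
      _ ≤ C * (4 * ‖z‖) ^ N := by gcongr
  have hint : ∀ N, IntegrableOn (fun p => (P p N : ℂ) * z ^ N) (simplex n' a) := fun N =>
    ((integrableOn_coeff_simplex a hP N).1.ofReal (𝕜 := ℂ)).mul_const (z ^ N)
  have h := hasSum_integral_of_summable_integral_norm hint (hqs.congr fun N => by
    rw [hq, ← integral_mul_const]
    exact setIntegral_congr_fun (measurableSet_simplex a) fun p hp =>
      (hP.norm_term (hmem p hp) z N).symm)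
  have h2 : ∀ p, ∑' N, (P p N : ℂ) * z ^ N = integrand n' a p z := fun p =>
    (hP.hasPS p (‖z‖ + 1) z (by linarith)).tsum_eq
  simp only [h2] at h
  refine h.congr_fun fun N => ?_
  rw [integral_mul_const, integral_complex_ofReal]

end ArcAsymptotics

namespace ArcAsymptotics

variable {n r : ℕ}

lemma norm_prod_signs (ε : Fin n → ℤˣ) : ‖∏ j, ((ε j : ℤ) : ℂ)‖ = 1 := by
  rw [norm_prod]
  refine Finset.prod_eq_one fun j _ => ?_
  rcases Int.units_eq_one_or (ε j) with h | h <;> simp [h]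

lemma norm_sum_signs_le (a : ArcDatum n r) {f : (Fin n → ℤˣ) → Fin r → ℂ} {C : ℝ}
    (hf : ∀ ε i, ‖f ε i‖ ≤ C * (1 / (a.ι i : ℝ))) :
    ‖∑ ε : Fin n → ℤˣ, (∏ j, ((ε j : ℤ) : ℂ)) * ∏ i, f ε i‖ ≤
      (Fintype.card (Fin n → ℤˣ) * C ^ r) * ∏ i, 1 / (a.ι i : ℝ) := by
  refine (norm_sum_le _ _).trans ?_
  have h1 : ∀ ε ∈ (Finset.univ : Finset (Fin n → ℤˣ)),
      ‖(∏ j, ((ε j : ℤ) : ℂ)) * ∏ i, f ε i‖ ≤ C ^ r * ∏ i, 1 / (a.ι i : ℝ) := by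
    intro ε _
    rw [norm_mul, norm_prod_signs, one_mul, norm_prod]
    refine (Finset.prod_le_prod (fun i _ => norm_nonneg _) fun i _ => hf ε i).trans_eq ?_
    rw [Finset.prod_mul_distrib, Finset.prod_const, Finset.card_univ, Fintype.card_fin]
  refine (Finset.sum_le_sum h1).trans_eq ?_
  rw [Finset.sum_const, nsmul_eq_mul, Finset.card_univ, mul_assoc]

lemma sum_signs_neg (F : (Fin n → ℤˣ) → ℂ) :
    ∑ ε : Fin n → ℤˣ, (∏ j, ((ε j : ℤ) : ℂ)) * F (-ε) =
      (-1) ^ n * ∑ ε : Fin n → ℤˣ, (∏ j, ((ε j : ℤ) : ℂ)) * F ε := by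
  rw [← Equiv.sum_comp (Equiv.neg (Fin n → ℤˣ)), Finset.mul_sum]
  refine Finset.sum_congr rfl fun ε _ => ?_
  simp only [Equiv.neg_apply, neg_neg, Pi.neg_apply, Units.val_neg, Int.cast_neg]
  rw [Finset.prod_neg, Finset.card_univ, Fintype.card_fin]
  ring

lemma signedSum_neg (a : ArcDatum n r) (ε : Fin n → ℤˣ) (i : Fin r) :
    signedSum a (-ε) i = -signedSum a ε i := by
  simp [signedSum]

lemma phiTerm_neg (a : ArcDatum n r) (z : ℂ) : phiTerm a (-z) = (-1) ^ n * phiTerm a z := by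
  rw [phiTerm_eq, phiTerm_eq, ← sum_signs_neg]
  refine Finset.sum_congr rfl fun ε _ => ?_
  simp [signedSum_neg]

lemma norm_sub_ge {m : ℕ} {s : ℤ} (hs : s = 2 ∨ s = 0 ∨ s = -2) {z : ℂ} :
    (m : ℝ) - 2 * ‖z‖ ≤ ‖(m : ℂ) - s * z‖ := by
  have h1 : ‖(s : ℂ) * z‖ ≤ 2 * ‖z‖ := by
    rw [norm_mul]
    refine mul_le_mul_of_nonneg_right ?_ (norm_nonneg z)
    rcases hs with h | h | h <;> rw [h] <;> norm_num
  have h2 := norm_sub_norm_le (m : ℂ) (s * z)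
  rw [Complex.norm_natCast] at h2
  linarith

lemma exists_norm_inv_le (z : ℂ) : ∃ C : ℝ, ∀ m : ℕ, 1 ≤ m → ∀ s : ℤ, s = 2 ∨ s = 0 ∨ s = -2 →
    ‖1 / ((m : ℂ) - s * z)‖ ≤ C * (1 / (m : ℝ)) := by
  obtain ⟨M, hM⟩ := exists_nat_ge (4 * ‖z‖)
  have hnn : ∀ (m : ℕ) (s : ℤ), 0 ≤ (m : ℝ) * ‖1 / ((m : ℂ) - s * z)‖ := fun m s => by positivity
  refine ⟨2 + ∑ m ∈ Finset.range M, ∑ s ∈ ({2, 0, -2} : Finset ℤ),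
    (m : ℝ) * ‖1 / ((m : ℂ) - s * z)‖, fun m hm s hs => ?_⟩
  have hm0 : (0 : ℝ) < m := by exact_mod_cast hm
  rw [mul_one_div, le_div_iff₀ hm0, mul_comm]
  rcases lt_or_ge m M with h | h
  · have h1 : (m : ℝ) * ‖1 / ((m : ℂ) - s * z)‖ ≤ ∑ s ∈ ({2, 0, -2} : Finset ℤ),
        (m : ℝ) * ‖1 / ((m : ℂ) - s * z)‖ :=
      Finset.single_le_sum (f := fun s : ℤ => (m : ℝ) * ‖1 / ((m : ℂ) - s * z)‖)
        (fun s _ => hnn m s) (by simpa using hs)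
    have h2 := Finset.single_le_sum (f := fun m : ℕ => ∑ s ∈ ({2, 0, -2} : Finset ℤ),
        (m : ℝ) * ‖1 / ((m : ℂ) - s * z)‖) (fun m _ => Finset.sum_nonneg fun s _ => hnn m s)
        (Finset.mem_range.2 h)
    linarith
  · have h1 : (M : ℝ) ≤ m := by exact_mod_cast h
    have h2 := norm_sub_ge (m := m) hs (z := z)
    have h3 : (m : ℝ) / 2 ≤ ‖(m : ℂ) - s * z‖ := by linarith
    have h4 : (m : ℝ) * ‖1 / ((m : ℂ) - s * z)‖ ≤ 2 := by
      rw [norm_div, norm_one, mul_one_div, div_le_iff₀ (by linarith)]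
      linarith
    have : 0 ≤ ∑ m ∈ Finset.range M, ∑ s ∈ ({2, 0, -2} : Finset ℤ),
        (m : ℝ) * ‖1 / ((m : ℂ) - s * z)‖ :=
      Finset.sum_nonneg fun m _ => Finset.sum_nonneg fun s _ => hnn m s
    linarith

variable {A : Type*} {D : A → ArcDatum n r}

lemma summable_phiTerm (hV : Summable fun α => ∏ i, 1 / ((D α).ι i : ℝ)) (z : ℂ) :
    Summable fun α => phiTerm (D α) z := by
  obtain ⟨C, hC⟩ := exists_norm_inv_le z
  refine Summable.of_norm_bounded (hV.mul_left (Fintype.card (Fin n → ℤˣ) * C ^ r)) fun α => ?_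
  rw [phiTerm_eq]
  exact norm_sum_signs_le (D α) fun ε i => hC _ ((D α).ι_pos i) _ (signedSum_cases _ _ _)

/-- The function `(1 - w²) / (m - s z)`, `w = 2 z / m`, without its removable singularities if
`m = m₀`, and `1 / (m - s z)` otherwise. -/
def regFactor (m₀ m : ℕ) (s : ℤ) (z : ℂ) : ℂ :=
  if m = m₀ then 1 / (m₀ : ℂ) * (1 + s * z / m₀ - (4 - s ^ 2) * z ^ 2 / m₀ ^ 2)
  else 1 / ((m : ℂ) - s * z)

lemma regFactor_eq {m₀ m : ℕ} (hm₀ : 1 ≤ m₀) {s : ℤ} (hs : s = 2 ∨ s = 0 ∨ s = -2) {z : ℂ}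
    (h1 : z ≠ (m₀ : ℂ) / 2) (h2 : z ≠ -((m₀ : ℂ) / 2)) :
    regFactor m₀ m s z = 1 / ((m : ℂ) - s * z) *
      if m = m₀ then 1 - (2 * z / m₀) ^ 2 else 1 := by
  unfold regFactor
  split_ifs with h
  · subst h
    have hm : (m : ℂ) ≠ 0 := by exact_mod_cast (by omega)
    have h1' : (m : ℂ) - 2 * z ≠ 0 := fun h => h1 (by linear_combination (-1 / 2 : ℂ) * h)
    have h2' : (m : ℂ) + 2 * z ≠ 0 := fun h => h2 (by linear_combination (1 / 2 : ℂ) * h)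
    rcases hs with h | h | h <;> subst h <;> push_cast
    · field_simp; ring
    · simp only [zero_mul, sub_zero]; field_simp; ring
    · rw [show (m : ℂ) - -2 * z = m + 2 * z by ring]; field_simp; ring
  · rw [mul_one]

lemma regFactor_neg (m₀ m : ℕ) (s : ℤ) (z : ℂ) :
    regFactor m₀ m (-s) (-z) = regFactor m₀ m s z := by
  simp [regFactor]

lemma sub_ne_zero_of_norm_lt {m : ℕ} {s : ℤ} (hs : s = 2 ∨ s = 0 ∨ s = -2) {z : ℂ}
    (h : 2 * ‖z‖ < m) : (m : ℂ) - s * z ≠ 0 := by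
  rw [← norm_pos_iff]
  have := norm_sub_ge (m := m) hs (z := z)
  linarith

lemma differentiableAt_regFactor {m₀ m : ℕ} (hm : m₀ ≤ m) {s : ℤ}
    (hs : s = 2 ∨ s = 0 ∨ s = -2) {z : ℂ} (hz : ‖z‖ < (m₀ + 1) / 2) :
    DifferentiableAt ℂ (regFactor m₀ m s) z := by
  unfold regFactor
  by_cases h : m = m₀
  · simp only [h, if_true]
    fun_prop
  · simp only [h, if_false]
    have h1 : ((m₀ + 1 : ℕ) : ℝ) ≤ m := by exact_mod_cast (by omega)
    push_cast at h1
    exact (differentiableAt_const _).div (by fun_prop)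
      (sub_ne_zero_of_norm_lt hs (by linarith))

lemma norm_regFactor_le {m₀ m : ℕ} (hm₀ : 1 ≤ m₀) (hm : m₀ ≤ m) {s : ℤ}
    (hs : s = 2 ∨ s = 0 ∨ s = -2) {ρ : ℝ} (hρ : ρ < (m₀ + 1) / 2) {z : ℂ} (hz : ‖z‖ ≤ ρ) :
    ‖regFactor m₀ m s z‖ ≤ ((1 - 2 * ρ / (m₀ + 1))⁻¹ + (1 + 2 * ρ + 4 * ρ ^ 2)) *
      (1 / (m : ℝ)) := by
  have hρ0 : 0 ≤ ρ := (norm_nonneg z).trans hz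
  have hm1 : (1 : ℝ) ≤ m₀ := by exact_mod_cast hm₀
  have hδ : 0 < 1 - 2 * ρ / (m₀ + 1) := by
    rw [sub_pos, div_lt_one (by positivity)]; linarith
  have hmpos : (0 : ℝ) < m := by exact_mod_cast (by omega)
  unfold regFactor
  split_ifs with h
  · subst h
    rw [norm_mul, norm_div, norm_one, Complex.norm_natCast, mul_comm]
    refine mul_le_mul_of_nonneg_right ?_ (by positivity)
    have e1 : ‖(s : ℂ) * z / m‖ ≤ 2 * ρ := by
      rw [norm_div, norm_mul, Complex.norm_natCast, div_le_iff₀ hmpos]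
      have : ‖(s : ℂ)‖ ≤ 2 := by rcases hs with h | h | h <;> rw [h] <;> norm_num
      calc ‖(s : ℂ)‖ * ‖z‖ ≤ 2 * ρ := by gcongr
        _ ≤ 2 * ρ * m := le_mul_of_one_le_right (by positivity) hm1
    have e2 : ‖(4 - (s : ℂ) ^ 2) * z ^ 2 / m ^ 2‖ ≤ 4 * ρ ^ 2 := by
      rw [norm_div, norm_mul, norm_pow, norm_pow, Complex.norm_natCast, div_le_iff₀ (by positivity)]
      have : ‖(4 - (s : ℂ) ^ 2)‖ ≤ 4 := by rcases hs with h | h | h <;> rw [h] <;> norm_num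
      calc ‖(4 - (s : ℂ) ^ 2)‖ * ‖z‖ ^ 2 ≤ 4 * ρ ^ 2 := by gcongr
        _ ≤ 4 * ρ ^ 2 * m ^ 2 := le_mul_of_one_le_right (by positivity) (one_le_pow₀ hm1)
    have e3 := norm_sub_le (1 + (s : ℂ) * z / m) ((4 - (s : ℂ) ^ 2) * z ^ 2 / m ^ 2)
    have e4 := norm_add_le (1 : ℂ) ((s : ℂ) * z / m)
    rw [norm_one] at e4
    have := inv_pos.2 hδ
    linarith
  · have h1 : ((m₀ + 1 : ℕ) : ℝ) ≤ m := by exact_mod_cast (by omega)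
    push_cast at h1
    have h2 := norm_sub_ge (m := m) hs (z := z)
    have h3 : (1 - 2 * ρ / (m₀ + 1)) * m ≤ ‖(m : ℂ) - s * z‖ := by
      refine le_trans ?_ h2
      have : 2 * ρ ≤ 2 * ρ / (m₀ + 1) * m := by
        rw [div_mul_eq_mul_div, le_div_iff₀ (by positivity)]
        gcongr
      linarith
    have h4 : ‖1 / ((m : ℂ) - s * z)‖ ≤ (1 - 2 * ρ / (m₀ + 1))⁻¹ * (1 / m) := by
      rw [norm_div, norm_one, ← one_div, one_div_mul_one_div]
      exact one_div_le_one_div_of_le (by positivity) h3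
    refine h4.trans (mul_le_mul_of_nonneg_right ?_ (by positivity))
    have : 0 ≤ 1 + 2 * ρ + 4 * ρ ^ 2 := by positivity
    linarith

/-- The number of indices at which the integer `m₀` is attained. -/
def multiplicity (m₀ : ℕ) (a : ArcDatum n r) : ℕ :=
  (Finset.univ.filter fun i => a.ι i = m₀).card

/-- The function `(1 - w²)^μ · phiTerm a z`, `w = 2 z / m₀`, without its removable
singularities. -/
def regTerm (m₀ μ : ℕ) (a : ArcDatum n r) (z : ℂ) : ℂ :=
  (∑ ε : Fin n → ℤˣ, (∏ j, ((ε j : ℤ) : ℂ)) * ∏ i, regFactor m₀ (a.ι i) (signedSum a ε i) z) *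
    (1 - (2 * z / m₀) ^ 2) ^ (μ - multiplicity m₀ a)

lemma regTerm_eq {m₀ μ : ℕ} (hm₀ : 1 ≤ m₀) {a : ArcDatum n r} (hμ : multiplicity m₀ a ≤ μ)
    {z : ℂ} (h1 : z ≠ (m₀ : ℂ) / 2) (h2 : z ≠ -((m₀ : ℂ) / 2)) :
    regTerm m₀ μ a z = phiTerm a z * (1 - (2 * z / m₀) ^ 2) ^ μ := by
  rw [regTerm, phiTerm_eq]
  have h3 : ∀ ε : Fin n → ℤˣ, ∏ i, regFactor m₀ (a.ι i) (signedSum a ε i) z =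
      (∏ i, 1 / ((a.ι i : ℂ) - signedSum a ε i * z)) *
        (1 - (2 * z / m₀) ^ 2) ^ multiplicity m₀ a := by
    intro ε
    rw [Finset.prod_congr rfl fun i _ => regFactor_eq hm₀ (signedSum_cases a ε i) h1 h2,
      Finset.prod_mul_distrib, Finset.prod_ite, Finset.prod_const, Finset.prod_const_one, mul_one]
    rfl
  simp only [h3, ← mul_assoc]
  rw [← Finset.sum_mul, mul_assoc, ← pow_add, Nat.add_sub_cancel' hμ]

lemma regTerm_neg (m₀ μ : ℕ) (a : ArcDatum n r) (z : ℂ) :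
    regTerm m₀ μ a (-z) = (-1) ^ n * regTerm m₀ μ a z := by
  rw [regTerm, regTerm, ← mul_assoc, ← sum_signs_neg]
  congr 1
  · refine Finset.sum_congr rfl fun ε _ => ?_
    congr 1
    refine Finset.prod_congr rfl fun i _ => ?_
    rw [signedSum_neg, ← regFactor_neg, neg_neg]
  · rw [mul_neg, neg_div, neg_sq]

lemma norm_regTerm_le {m₀ μ : ℕ} (hm₀ : 1 ≤ m₀) {a : ArcDatum n r} (ha : ∀ i, m₀ ≤ a.ι i)
    {ρ : ℝ} (hρ : ρ < (m₀ + 1) / 2) {z : ℂ} (hz : ‖z‖ ≤ ρ) :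
    ‖regTerm m₀ μ a z‖ ≤ (Fintype.card (Fin n → ℤˣ) *
      ((1 - 2 * ρ / (m₀ + 1))⁻¹ + (1 + 2 * ρ + 4 * ρ ^ 2)) ^ r) * (1 + (2 * ρ) ^ 2) ^ μ *
        ∏ i, 1 / (a.ι i : ℝ) := by
  have hρ0 : 0 ≤ ρ := (norm_nonneg z).trans hz
  have hm1 : (1 : ℝ) ≤ m₀ := by exact_mod_cast hm₀
  have h1 := norm_sum_signs_le a (f := fun ε i => regFactor m₀ (a.ι i) (signedSum a ε i) z)
    fun ε i => norm_regFactor_le hm₀ (ha i) (signedSum_cases a ε i) hρ hz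
  have h2 : ‖1 - (2 * z / (m₀ : ℂ)) ^ 2‖ ≤ 1 + (2 * ρ) ^ 2 := by
    refine (norm_sub_le _ _).trans ?_
    rw [norm_one, norm_pow, norm_div, norm_mul, Complex.norm_natCast, Complex.norm_ofNat]
    gcongr
    exact (div_le_self (by positivity) hm1).trans (by gcongr)
  have h3 : ‖(1 - (2 * z / (m₀ : ℂ)) ^ 2) ^ (μ - multiplicity m₀ a)‖ ≤ (1 + (2 * ρ) ^ 2) ^ μ := by
    rw [norm_pow]
    calc _ ≤ (1 + (2 * ρ) ^ 2) ^ (μ - multiplicity m₀ a) := by gcongr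
      _ ≤ _ := pow_le_pow_right₀ (le_add_of_nonneg_right (by positivity)) (Nat.sub_le _ _)
  rw [regTerm, norm_mul, mul_right_comm]
  exact mul_le_mul h1 h3 (norm_nonneg _) ((norm_nonneg _).trans h1)

lemma differentiableAt_regTerm {m₀ μ : ℕ} {a : ArcDatum n r} (ha : ∀ i, m₀ ≤ a.ι i) {z : ℂ}
    (hz : ‖z‖ < (m₀ + 1) / 2) : DifferentiableAt ℂ (regTerm m₀ μ a) z := by
  unfold regTerm
  refine DifferentiableAt.mul (DifferentiableAt.fun_sum fun ε _ => ?_) (by fun_prop)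
  refine (differentiableAt_const _).mul (DifferentiableAt.fun_finsetProd fun i _ => ?_)
  exact differentiableAt_regFactor (ha i) (signedSum_cases a ε i) hz

/-- The regular part `(1 - w²)^μ · phi`, `w = 2 z / m₀`. -/
def regPart (m₀ μ : ℕ) (D : A → ArcDatum n r) (z : ℂ) : ℂ := ∑' α, regTerm m₀ μ (D α) z

section regPart

variable {m₀ μ : ℕ}

lemma summable_regTerm (hV : Summable fun α => ∏ i, 1 / ((D α).ι i : ℝ)) (hm₀ : 1 ≤ m₀)
    (hD : ∀ α i, m₀ ≤ (D α).ι i) {z : ℂ} (hz : ‖z‖ < (m₀ + 1) / 2) :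
    Summable fun α => regTerm m₀ μ (D α) z :=
  Summable.of_norm_bounded (hV.mul_left _) fun α => norm_regTerm_le hm₀ (hD α) hz le_rfl

lemma differentiableOn_regPart (hV : Summable fun α => ∏ i, 1 / ((D α).ι i : ℝ)) (hm₀ : 1 ≤ m₀)
    (hD : ∀ α i, m₀ ≤ (D α).ι i) :
    DifferentiableOn ℂ (regPart m₀ μ D) (Metric.ball 0 ((m₀ + 1) / 2)) := by
  intro z hz
  obtain ⟨ρ, h1, h2⟩ := exists_between (mem_ball_zero_iff.1 hz)
  have h3 : DifferentiableOn ℂ (regPart m₀ μ D) (Metric.ball 0 ρ) := by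
    refine Complex.differentiableOn_tsum_of_summable_norm (hV.mul_left _) (fun α w hw => ?_)
      Metric.isOpen_ball fun α w hw =>
        norm_regTerm_le hm₀ (hD α) h2 (mem_ball_zero_iff.1 hw).le
    exact (differentiableAt_regTerm (hD α)
      ((mem_ball_zero_iff.1 hw).trans h2)).differentiableWithinAt
  exact (h3.differentiableAt (Metric.isOpen_ball.mem_nhds
    (mem_ball_zero_iff.2 h1))).differentiableWithinAt

lemma regPart_neg (z : ℂ) : regPart m₀ μ D (-z) = (-1) ^ n * regPart m₀ μ D z := by
  simp only [regPart, regTerm_neg, tsum_mul_left]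

lemma phi_neg (z : ℂ) : phi D (-z) = (-1) ^ n * phi D z := by
  simp only [phi, phiTerm_neg, tsum_mul_left]

lemma regPart_eq (hm₀ : 1 ≤ m₀) (hμ : ∀ α, multiplicity m₀ (D α) ≤ μ)
    {z : ℂ} (h1 : z ≠ (m₀ : ℂ) / 2) (h2 : z ≠ -((m₀ : ℂ) / 2)) :
    regPart m₀ μ D z = phi D z * (1 - (2 * z / m₀) ^ 2) ^ μ := by
  rw [regPart, phi, ← tsum_mul_right]
  exact tsum_congr fun α => regTerm_eq hm₀ (hμ α) h1 h2

lemma ne_zero_of_tsum_ofReal {f : A → ℂ} {v : A → ℝ} (hf : ∀ α, f α = v α) (hs : Summable f)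
    (h0 : ∀ α, 0 ≤ v α) {α₀ : A} (h1 : 0 < v α₀) : ∑' α, f α ≠ 0 := by
  have hs' : Summable v := Complex.summable_ofReal.1 (hs.congr hf)
  simp only [hf]
  rw [← Complex.ofReal_tsum]
  exact_mod_cast (hs'.tsum_pos h0 α₀ h1).ne'

lemma phi_ne_zero [Nonempty A] (hV : Summable fun α => ∏ i, 1 / ((D α).ι i : ℝ)) {x : ℝ}
    (hx : 0 < x) (hD : ∀ α i, 2 * x < (D α).ι i) : phi D (x : ℂ) ≠ 0 := by
  have hpos : ∀ α, 0 < ∑ ε : Fin n → ℤˣ, (∏ j, ((ε j : ℤ) : ℝ)) *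
      ∏ i, 1 / (((D α).ι i : ℝ) - signedSum (D α) ε i * x) := fun α =>
    sum_signs_prod_pos (D α) (fun i s => 1 / (((D α).ι i : ℝ) - s * x)) fun i =>
      isSignConvex_inv hx (hD α i)
  refine ne_zero_of_tsum_ofReal (fun α => ?_) (summable_phiTerm hV x) (fun α => (hpos α).le)
    (hpos (Classical.arbitrary A))
  rw [phiTerm_eq]
  push_cast
  rfl

lemma regFactor_half {m : ℕ} (hm₀ : 1 ≤ m₀) {s : ℤ} (hs : s = 2 ∨ s = 0 ∨ s = -2) :
    regFactor m₀ m s ((m₀ : ℂ) / 2) = (((if m = m₀ then (if s = 2 then (2 / m₀ : ℝ) else 0) else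
      1 / ((m : ℝ) - s * (m₀ / 2 : ℝ))) : ℝ) : ℂ) := by
  have hm : (m₀ : ℂ) ≠ 0 := by exact_mod_cast (by omega)
  unfold regFactor
  split_ifs with h h'
  · subst h'; push_cast; field_simp; ring
  · rcases hs with h'' | h'' | h''
    · exact absurd h'' h'
    all_goals
      subst h''
      push_cast
      field_simp
      ring
  · push_cast; rfl

lemma regPart_ne_zero (hV : Summable fun α => ∏ i, 1 / ((D α).ι i : ℝ)) (hm₀ : 1 ≤ m₀)
    (hD : ∀ α i, m₀ ≤ (D α).ι i)
    (hμ' : ∃ α, multiplicity m₀ (D α) = μ) : regPart m₀ μ D ((m₀ : ℂ) / 2) ≠ 0 := by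
  have hm : (0 : ℝ) < m₀ := by exact_mod_cast hm₀
  have hmC : (m₀ : ℂ) ≠ 0 := by exact_mod_cast (by omega)
  have hpos : ∀ α, 0 < ∑ ε : Fin n → ℤˣ, (∏ j, ((ε j : ℤ) : ℝ)) *
      ∏ i, (if (D α).ι i = m₀ then (if signedSum (D α) ε i = 2 then (2 / m₀ : ℝ) else 0) else
      1 / (((D α).ι i : ℝ) - signedSum (D α) ε i * (m₀ / 2 : ℝ))) := fun α => by
    refine sum_signs_prod_pos (D α) (fun i s => (if (D α).ι i = m₀ then
      (if s = 2 then (2 / m₀ : ℝ) else 0) else 1 / (((D α).ι i : ℝ) - s * (m₀ / 2 : ℝ)))) fun i => ?_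
    by_cases h : (D α).ι i = m₀
    · simp only [h, if_true]
      exact isSignConvex_indicator (by positivity)
    · simp only [h, if_false]
      refine isSignConvex_inv (by positivity) ?_
      have : m₀ < (D α).ι i := lt_of_le_of_ne (hD α i) (Ne.symm h)
      have : (m₀ : ℝ) < (D α).ι i := by exact_mod_cast this
      linarith
  obtain ⟨α₀, hα₀⟩ := hμ'
  refine ne_zero_of_tsum_ofReal (v := fun α => (∑ ε : Fin n → ℤˣ, (∏ j, ((ε j : ℤ) : ℝ)) *
      ∏ i, (if (D α).ι i = m₀ then (if signedSum (D α) ε i = 2 then (2 / m₀ : ℝ) else 0) else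
      1 / (((D α).ι i : ℝ) - signedSum (D α) ε i * (m₀ / 2 : ℝ)))) *
        (0 : ℝ) ^ (μ - multiplicity m₀ (D α)))
    (fun α => ?_) (summable_regTerm hV hm₀ hD ?_) (fun α => ?_) (α₀ := α₀) ?_
  · rw [regTerm]
    simp only [regFactor_half hm₀ (signedSum_cases (D α) _ _)]
    have : (1 : ℂ) - (2 * ((m₀ : ℂ) / 2) / m₀) ^ 2 = 0 := by field_simp; ring
    rw [this]
    push_cast
    rfl
  · rw [norm_div, Complex.norm_natCast, Complex.norm_ofNat]; linarith
  · exact mul_nonneg (hpos α).le (by positivity)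
  · rw [hα₀, Nat.sub_self, pow_zero, mul_one]
    exact hpos α₀

end regPart

end ArcAsymptotics

namespace ArcAsymptotics

variable {A : Type*} {n r n' : ℕ} {D : A → ArcDatum n r}

lemma differentiable_varphi (n' : ℕ) (a : ArcDatum n r) : Differentiable ℂ (varphi n' a) := by
  obtain ⟨q, hq, -⟩ := exists_hasPS_varphi n' a
  intro z
  exact (hq (‖z‖ + 1)).differentiableOn.differentiableAt
    (Metric.isOpen_ball.mem_nhds (mem_ball_zero_iff.2 (by linarith)))

lemma hasSum_brevePS (n' : ℕ) (a : ArcDatum n r) :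
    HasPS (1 / 2) (fun z => phiTerm a z / 2 ^ n * sinhLog z ^ n')
      (fun N => PowerSeries.coeff N (brevePS n' a)) := by
  obtain ⟨q, hq, hB⟩ := exists_hasPS_varphi n' a
  intro z hz
  refine (hB z hz).congr_fun fun N => ?_
  simp only [brevePS, borel, PowerSeries.coeff_mk, (hq 1).taylorCoeff_eq one_pos]

lemma breveTerm_eq (n' : ℕ) (a : ArcDatum n r) {z : ℂ} (hz : ‖z‖ < 1 / 2) :
    breveTerm n' a z = phiTerm a z / 2 ^ n * sinhLog z ^ n' :=
  (hasSum_brevePS n' a z hz).tsum_eq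

lemma breve_eq (n' : ℕ) {z : ℂ} (hz : ‖z‖ < 1 / 2) :
    breve n' D z = phi D z / 2 ^ n * sinhLog z ^ n' := by
  simp only [breve, breveTerm_eq n' _ hz, phi, tsum_mul_right, tsum_div_const]

lemma iotaMin_le (α : A) (i : Fin r) : iotaMin D ≤ (D α).ι i := Nat.sInf_le ⟨α, i, rfl⟩

lemma exists_eq_iotaMin [Nonempty A] (hr : 1 ≤ r) : ∃ α i, (D α).ι i = iotaMin D :=
  Nat.sInf_mem (s := {m | ∃ α i, (D α).ι i = m})
    ⟨_, Classical.arbitrary A, ⟨0, hr⟩, rfl⟩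

lemma one_le_iotaMin [Nonempty A] (hr : 1 ≤ r) : 1 ≤ iotaMin D := by
  obtain ⟨α, i, h⟩ := exists_eq_iotaMin (D := D) hr
  exact h ▸ (D α).ι_pos i

lemma bddAbove_multiplicity (m₀ : ℕ) : BddAbove {m | ∃ α, multiplicity m₀ (D α) = m} := by
  refine ⟨r, ?_⟩
  rintro m ⟨α, rfl⟩
  simpa [multiplicity] using Finset.card_filter_le (Finset.univ : Finset (Fin r)) _

lemma multiplicity_le_muMax (α : A) : multiplicity (iotaMin D) (D α) ≤ muMax D :=
  le_csSup (bddAbove_multiplicity (D := D) (iotaMin D)) ⟨α, rfl⟩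

lemma exists_multiplicity_eq_muMax [Nonempty A] :
    ∃ α, multiplicity (iotaMin D) (D α) = muMax D :=
  Nat.sSup_mem (s := {m | ∃ α, multiplicity (iotaMin D) (D α) = m})
    ⟨_, Classical.arbitrary A, rfl⟩ (bddAbove_multiplicity _)

lemma one_le_muMax [Nonempty A] (hr : 1 ≤ r) : 1 ≤ muMax D := by
  obtain ⟨α, i, h⟩ := exists_eq_iotaMin (D := D) hr
  exact (Finset.card_pos.2 ⟨i, by simpa using h⟩).trans_le (multiplicity_le_muMax α)

lemma half_iotaMin_mem_ball : (iotaMin D : ℂ) / 2 ∈ Metric.ball (0 : ℂ) ((iotaMin D + 1) / 2) := by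
  rw [mem_ball_zero_iff, norm_div, Complex.norm_natCast, Complex.norm_ofNat]
  linarith

variable [Nonempty A]

/-- The function `φ̃`, with `phi = φ̃ / (1 - 2 z / ι₀) ^ μ₀`. -/
def phiReg (D : A → ArcDatum n r) (z : ℂ) : ℂ :=
  regPart (iotaMin D) (muMax D) D z / (1 + 2 * z / iotaMin D) ^ muMax D

lemma iotaMin_ne_zero (hr : 1 ≤ r) : (iotaMin D : ℂ) ≠ 0 := by
  have := one_le_iotaMin (D := D) hr
  exact_mod_cast (by omega)

lemma analyticAt_phiReg (hr : 1 ≤ r) (hV : Summable fun α => ∏ i, 1 / ((D α).ι i : ℝ)) :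
    AnalyticAt ℂ (phiReg D) ((iotaMin D : ℂ) / 2) := by
  have h0 := iotaMin_ne_zero (D := D) hr
  refine AnalyticAt.div ?_ (by fun_prop) ?_
  · exact (differentiableOn_regPart hV (one_le_iotaMin hr) iotaMin_le).analyticAt
      (Metric.isOpen_ball.mem_nhds half_iotaMin_mem_ball)
  · refine pow_ne_zero _ ?_
    rw [show (1 : ℂ) + 2 * ((iotaMin D : ℂ) / 2) / iotaMin D = 2 by field_simp; norm_num]
    norm_num

lemma regPart_half (hr : 1 ≤ r) : regPart (iotaMin D) (muMax D) D ((iotaMin D : ℂ) / 2) =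
    phiReg D ((iotaMin D : ℂ) / 2) * 2 ^ muMax D := by
  have h0 := iotaMin_ne_zero (D := D) hr
  rw [phiReg, show (1 : ℂ) + 2 * ((iotaMin D : ℂ) / 2) / iotaMin D = 2 by field_simp; norm_num]
  field_simp

lemma regPart_half_ne_zero (hr : 1 ≤ r) (hV : Summable fun α => ∏ i, 1 / ((D α).ι i : ℝ)) :
    regPart (iotaMin D) (muMax D) D ((iotaMin D : ℂ) / 2) ≠ 0 :=
  regPart_ne_zero hV (one_le_iotaMin hr) iotaMin_le exists_multiplicity_eq_muMax

lemma phiReg_ne_zero (hr : 1 ≤ r) (hV : Summable fun α => ∏ i, 1 / ((D α).ι i : ℝ)) :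
    phiReg D ((iotaMin D : ℂ) / 2) ≠ 0 := fun h =>
  regPart_half_ne_zero hr hV (by rw [regPart_half hr, h, zero_mul])

lemma phi_eq_phiReg (hr : 1 ≤ r) : ∀ᶠ z in 𝓝[≠] ((iotaMin D : ℂ) / 2),
    phi D z = phiReg D z / (1 - z / ((iotaMin D : ℂ) / 2)) ^ muMax D := by
  have h0 := iotaMin_ne_zero (D := D) hr
  have hne : (iotaMin D : ℂ) / 2 ≠ -((iotaMin D : ℂ) / 2) := fun h => by
    apply h0; linear_combination h
  filter_upwards [self_mem_nhdsWithin, nhdsWithin_le_nhds (isOpen_ne.mem_nhds hne)] with z h1 h2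
  have h1 : z ≠ (iotaMin D : ℂ) / 2 := h1
  have h2 : z ≠ -((iotaMin D : ℂ) / 2) := h2
  have e1 : 1 - 2 * z / (iotaMin D : ℂ) ≠ 0 := fun h => h1 (by
    field_simp at h; linear_combination (-1 / 2 : ℂ) * h)
  have e2 : 1 + 2 * z / (iotaMin D : ℂ) ≠ 0 := fun h => h2 (by
    field_simp at h; linear_combination (1 / 2 : ℂ) * h)
  rw [phiReg, regPart_eq (one_le_iotaMin hr) multiplicity_le_muMax h1 h2,
    show 1 - z / ((iotaMin D : ℂ) / 2) = 1 - 2 * z / iotaMin D by field_simp,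
    show 1 - (2 * z / (iotaMin D : ℂ)) ^ 2 =
      (1 + 2 * z / iotaMin D) * (1 - 2 * z / iotaMin D) by ring, mul_pow,
    eq_div_iff (pow_ne_zero _ e1), eq_div_iff (pow_ne_zero _ e2)]
  ring

lemma phi_eq_of_norm_lt (hr : 1 ≤ r) {z : ℂ} (hz : ‖z‖ < (iotaMin D : ℝ) / 2) :
    1 - (2 * z / (iotaMin D : ℂ)) ^ 2 ≠ 0 ∧ phi D z =
      regPart (iotaMin D) (muMax D) D z * (1 / (1 - (2 * z / (iotaMin D : ℂ)) ^ 2)) ^ muMax D := by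
  have h0 := iotaMin_ne_zero (D := D) hr
  have hn : ‖(iotaMin D : ℂ) / 2‖ = (iotaMin D : ℝ) / 2 := by simp
  have h1 : z ≠ (iotaMin D : ℂ) / 2 := fun h => by rw [h, hn] at hz; exact lt_irrefl _ hz
  have h2 : z ≠ -((iotaMin D : ℂ) / 2) := fun h => by
    rw [h, norm_neg, hn] at hz; exact lt_irrefl _ hz
  have h3 : 1 - (2 * z / (iotaMin D : ℂ)) ^ 2 ≠ 0 := by
    refine one_sub_ne_zero ?_
    have : (0 : ℝ) < iotaMin D := by exact_mod_cast one_le_iotaMin (D := D) hr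
    rw [norm_pow, norm_div, norm_mul, Complex.norm_natCast, Complex.norm_ofNat]
    refine pow_lt_one₀ (by positivity) ?_ two_ne_zero
    rw [div_lt_one this]; linarith
  refine ⟨h3, ?_⟩
  rw [regPart_eq (one_le_iotaMin hr) multiplicity_le_muMax h1 h2, mul_assoc, ← mul_pow,
    mul_one_div_cancel h3, one_pow, mul_one]

lemma differentiableOn_phi (hr : 1 ≤ r) (hV : Summable fun α => ∏ i, 1 / ((D α).ι i : ℝ)) :
    DifferentiableOn ℂ (phi D) (Metric.ball 0 ((iotaMin D : ℝ) / 2)) := by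
  have h1 : DifferentiableOn ℂ (fun z => regPart (iotaMin D) (muMax D) D z *
      (1 / (1 - (2 * z / (iotaMin D : ℂ)) ^ 2)) ^ muMax D)
      (Metric.ball 0 ((iotaMin D : ℝ) / 2)) := by
    refine DifferentiableOn.mul ((differentiableOn_regPart hV (one_le_iotaMin hr)
      iotaMin_le).mono (Metric.ball_subset_ball (by linarith))) (DifferentiableOn.pow ?_ _)
    exact (differentiableOn_const _).div (by fun_prop) fun z hz =>
      (phi_eq_of_norm_lt hr (mem_ball_zero_iff.1 hz)).1
  exact h1.congr fun z hz => (phi_eq_of_norm_lt hr (mem_ball_zero_iff.1 hz)).2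

lemma sinhLog_pow (n' : ℕ) (z : ℂ) :
    sinhLog z ^ n' = 1 / 4 ^ n' * (-Complex.log (1 - (2 * z) ^ 2)) ^ n' := by
  rw [sinhLog, mul_pow, one_div_pow, show (2 * z) ^ 2 = 4 * z ^ 2 by ring]

lemma half_le_half_iotaMin (hr : 1 ≤ r) : (1 : ℝ) / 2 ≤ (iotaMin D : ℝ) / 2 := by
  have : (1 : ℝ) ≤ iotaMin D := by exact_mod_cast one_le_iotaMin (D := D) hr
  linarith

lemma analyticOnNhd_breve (n' : ℕ) (hr : 1 ≤ r)
    (hV : Summable fun α => ∏ i, 1 / ((D α).ι i : ℝ)) :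
    AnalyticOnNhd ℂ (breve n' D) (Metric.ball 0 (1 / 2)) := by
  refine DifferentiableOn.analyticOnNhd ?_ Metric.isOpen_ball
  have h1 : DifferentiableOn ℂ (fun z => phi D z / 2 ^ n * sinhLog z ^ n')
      (Metric.ball 0 (1 / 2)) :=
    (((differentiableOn_phi hr hV).mono (Metric.ball_subset_ball
      (half_le_half_iotaMin hr))).div_const _).mul (hasPS_sinhLog.differentiableOn.pow n')
  exact h1.congr fun z hz => breve_eq n' (mem_ball_zero_iff.1 hz)

theorem isEquivalent_breve_zero (hr : 1 ≤ r)
    (hV : Summable fun α => ∏ i, 1 / ((D α).ι i : ℝ)) :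
    Asymptotics.IsEquivalent atTop (fun N : ℕ => taylorCoeff (breve 0 D) N)
      (fun N : ℕ => (1 + (-1 : ℂ) ^ (n + N)) * phiReg D ((iotaMin D : ℂ) / 2) *
        (2 : ℂ) ^ (-(n : ℤ)) * (2 / (iotaMin D : ℂ)) ^ N *
          ((N : ℂ) ^ (muMax D - 1) / ((muMax D - 1).factorial : ℂ))) := by
  obtain ⟨ν, hν⟩ : ∃ ν, muMax D = ν + 1 := ⟨muMax D - 1, by
    have := one_le_muMax (D := D) hr; omega⟩
  have h0 := iotaMin_ne_zero (D := D) hr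
  have hpos : (0 : ℝ) < iotaMin D := by exact_mod_cast one_le_iotaMin (D := D) hr
  have hc : (1 : ℂ) / ((2 / iotaMin D : ℝ) : ℂ) = (iotaMin D : ℂ) / 2 := by push_cast; field_simp
  obtain ⟨s1, s2⟩ := logPowCoeff_succ_slowly_varying ν 0
  have h := isEquivalent_taylorCoeff (F := breve 0 D) (G := regPart (iotaMin D) (muMax D) D)
    (K := 1 / 2 ^ n) (c := 2 / iotaMin D) (R := (iotaMin D + 1) / 2) (ρ := 1 / 2) (n := n)
    (by positivity) (by norm_num) (by rw [one_div_div]; exact half_le_half_iotaMin hr)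
    (by rw [one_div_div]; linarith)
    (differentiableOn_regPart hV (one_le_iotaMin hr) iotaMin_le) (fun z _ => regPart_neg z)
    (by rw [hc]; exact regPart_half_ne_zero hr hV) (hasPS_logPow (ν + 1) 0)
    (fun z hz => by
      rw [breve_eq 0 hz, (phi_eq_of_norm_lt hr (hz.trans_le (half_le_half_iotaMin hr))).2, hν]
      simp only [logPow, pow_zero]
      push_cast
      rw [show 2 / (iotaMin D : ℂ) * z = 2 * z / iotaMin D by ring]
      ring) s1 s2
  rw [hc, regPart_half hr] at h
  refine h.trans ((Asymptotics.IsEquivalent.refl.mul (Asymptotics.IsEquivalent.refl.mul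
    (isEquivalent_logPowCoeff_succ_half ν 0))).congr_right (Eventually.of_forall fun N => ?_))
  have hf : (ν.factorial : ℂ) ≠ 0 := by exact_mod_cast ν.factorial_ne_zero
  simp only [Pi.mul_apply, hν, Nat.add_sub_cancel, pow_zero, mul_one,
    zpow_neg, zpow_natCast]
  push_cast
  rw [pow_succ, div_pow (N : ℂ)]
  field_simp

theorem isEquivalent_breve_of_one_lt (hr : 1 ≤ r) (hn' : 0 < n')
    (hV : Summable fun α => ∏ i, 1 / ((D α).ι i : ℝ)) (hι : 1 < iotaMin D) :
    Asymptotics.IsEquivalent atTop (fun N : ℕ => taylorCoeff (breve n' D) N)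
      (fun N : ℕ => (1 + (-1 : ℂ) ^ (n + N)) * phi D (1 / 2) *
        (2 : ℂ) ^ ((N : ℤ) - n - 2 * n') *
          ((n' : ℂ) * ((Real.log N : ℝ) : ℂ) ^ (n' - 1) / (N : ℂ))) := by
  obtain ⟨k, rfl⟩ := Nat.exists_eq_succ_of_ne_zero hn'.ne'
  obtain ⟨s1, s2⟩ := logPowCoeff_zero_slowly_varying k
  have hι' : (1 : ℝ) < iotaMin D := by exact_mod_cast hι
  have hphi : phi D (1 / 2) ≠ 0 := by
    have := phi_ne_zero (D := D) hV (x := 1 / 2) (by norm_num) fun α i => by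
      have : (iotaMin D : ℝ) ≤ (D α).ι i := by exact_mod_cast iotaMin_le α i
      linarith
    simpa using this
  have h := isEquivalent_taylorCoeff (F := breve (k + 1) D) (G := phi D)
    (K := 1 / 2 ^ n * (1 / 4 ^ (k + 1))) (c := 2) (R := iotaMin D / 2) (ρ := 1 / 2) (n := n)
    (by norm_num) (by norm_num) le_rfl (by linarith) (differentiableOn_phi hr hV)
    (fun z _ => phi_neg z) (by simpa using hphi) (hasPS_logPow 0 (k + 1))
    (fun z hz => by
      rw [breve_eq _ hz, sinhLog_pow]
      simp only [logPow, pow_zero]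
      push_cast
      ring) s1 s2
  refine h.trans ((Asymptotics.IsEquivalent.refl.mul (Asymptotics.IsEquivalent.refl.mul
    (isEquivalent_logPowCoeff_zero_half k))).congr_right ?_)
  filter_upwards [eventually_gt_atTop 0] with N hN
  have hN' : (N : ℂ) ≠ 0 := by exact_mod_cast hN.ne'
  have h2 : (2 : ℂ) ^ ((N : ℤ) - n - 2 * ((k + 1 : ℕ) : ℤ)) = 2 ^ N / 2 ^ n / 4 ^ (k + 1) := by
    rw [zpow_sub₀ two_ne_zero, zpow_sub₀ two_ne_zero, zpow_natCast, zpow_natCast, zpow_mul]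
    norm_cast
  simp only [Pi.mul_apply, Nat.succ_eq_add_one, Nat.add_sub_cancel]
  rw [h2]
  push_cast
  field_simp

theorem isEquivalent_breve_of_eq_one (hr : 1 ≤ r)
    (hV : Summable fun α => ∏ i, 1 / ((D α).ι i : ℝ)) (hι : iotaMin D = 1) :
    Asymptotics.IsEquivalent atTop (fun N : ℕ => taylorCoeff (breve n' D) N)
      (fun N : ℕ => (1 + (-1 : ℂ) ^ (n + N)) * phiReg D (1 / 2) *
        (2 : ℂ) ^ ((N : ℤ) - n - 2 * n') *
          ((N : ℂ) ^ (muMax D - 1) / ((muMax D - 1).factorial : ℂ)) *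
            ((Real.log N : ℝ) : ℂ) ^ n') := by
  obtain ⟨ν, hν⟩ : ∃ ν, muMax D = ν + 1 := ⟨muMax D - 1, by
    have := one_le_muMax (D := D) hr; omega⟩
  obtain ⟨s1, s2⟩ := logPowCoeff_succ_slowly_varying ν n'
  have hg0 := regPart_half_ne_zero (D := D) hr hV
  have hg := regPart_half (D := D) hr
  have hd := differentiableOn_regPart (μ := muMax D) hV (one_le_iotaMin hr) (iotaMin_le (D := D))
  have hphi := fun z => phi_eq_of_norm_lt (D := D) hr (z := z)
  rw [hι] at hg0 hg hd hphi
  norm_num at hg0 hg hd hphi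
  have h := isEquivalent_taylorCoeff (F := breve n' D) (G := regPart 1 (muMax D) D)
    (K := 1 / 2 ^ n * (1 / 4 ^ n')) (c := 2) (R := 1) (ρ := 1 / 2) (n := n)
    (by norm_num) (by norm_num) le_rfl (by norm_num) hd
    (fun z _ => regPart_neg z) (by simpa using hg0) (hasPS_logPow (ν + 1) n')
    (fun z hz => by
      rw [breve_eq _ hz, sinhLog_pow, (hphi z hz).2, hν]
      simp only [logPow]
      push_cast
      rw [one_div (1 - (2 * z) ^ 2), inv_pow]
      ring) s1 s2
  refine h.trans ((Asymptotics.IsEquivalent.refl.mul (Asymptotics.IsEquivalent.refl.mul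
    (isEquivalent_logPowCoeff_succ_half ν n'))).congr_right (Eventually.of_forall fun N => ?_))
  have hf : (ν.factorial : ℂ) ≠ 0 := by exact_mod_cast ν.factorial_ne_zero
  have h2 : (2 : ℂ) ^ ((N : ℤ) - n - 2 * (n' : ℤ)) = 2 ^ N / 2 ^ n / 4 ^ n' := by
    rw [zpow_sub₀ two_ne_zero, zpow_sub₀ two_ne_zero, zpow_natCast, zpow_natCast, zpow_mul]
    norm_cast
  have h3 : regPart 1 (muMax D) D (1 / ((2 : ℝ) : ℂ)) = phiReg D (1 / 2) * 2 ^ muMax D := by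
    push_cast; exact hg
  simp only [Pi.mul_apply]
  rw [h2, h3]
  simp only [hν, Nat.add_sub_cancel]
  push_cast
  rw [pow_succ, div_pow (N : ℂ)]
  field_simp

end ArcAsymptotics

end

theorem mainTheorem12 {A : Type*} [Countable A] [Nonempty A] (n n' r : ℕ)
    (hn : 1 ≤ n) (hr : 1 ≤ r) (D : A → ArcAsymptotics.ArcDatum n r)
    (hV : Summable fun α => ∏ i, 1 / ((D α).ι i : ℝ)) :
    -- the objects are well defined
    (∀ α, Differentiable ℂ (ArcAsymptotics.varphi n' (D α))) ∧
    (∀ z : ℂ, ‖z‖ < 1 / 2 →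
      (∀ α, Summable fun N : ℕ =>
        PowerSeries.coeff N (ArcAsymptotics.brevePS n' (D α)) * z ^ N) ∧
      Summable fun α => ArcAsymptotics.breveTerm n' (D α) z) ∧
    AnalyticOnNhd ℂ (ArcAsymptotics.breve n' D) (Metric.ball 0 (1 / 2)) ∧
    (∀ z : ℂ, (∀ α i, z ≠ ((D α).ι i : ℂ) / 2 ∧ z ≠ -(((D α).ι i : ℂ) / 2)) →
      Summable fun α => ArcAsymptotics.phiTerm (D α) z) ∧
    -- the leading coefficient of `phi` at its pole `ι₀ / 2`, and the three asymptotics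
    ∃ φt : ℂ → ℂ,
      AnalyticAt ℂ φt ((ArcAsymptotics.iotaMin D : ℂ) / 2) ∧
      φt ((ArcAsymptotics.iotaMin D : ℂ) / 2) ≠ 0 ∧
      (∀ᶠ z in 𝓝[≠] ((ArcAsymptotics.iotaMin D : ℂ) / 2),
        ArcAsymptotics.phi D z =
          φt z / (1 - z / ((ArcAsymptotics.iotaMin D : ℂ) / 2)) ^ ArcAsymptotics.muMax D) ∧
      (n' = 0 →
        Asymptotics.IsEquivalent atTop
          (fun N : ℕ => ArcAsymptotics.taylorCoeff (ArcAsymptotics.breve n' D) N)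
          (fun N : ℕ => (1 + (-1 : ℂ) ^ (n + N)) * φt ((ArcAsymptotics.iotaMin D : ℂ) / 2) *
            (2 : ℂ) ^ (-(n : ℤ)) * (2 / (ArcAsymptotics.iotaMin D : ℂ)) ^ N *
            ((N : ℂ) ^ (ArcAsymptotics.muMax D - 1) /
              ((ArcAsymptotics.muMax D - 1).factorial : ℂ)))) ∧
      (0 < n' → 1 < ArcAsymptotics.iotaMin D →
        Asymptotics.IsEquivalent atTop
          (fun N : ℕ => ArcAsymptotics.taylorCoeff (ArcAsymptotics.breve n' D) N)
          (fun N : ℕ => (1 + (-1 : ℂ) ^ (n + N)) * ArcAsymptotics.phi D (1 / 2) *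
            (2 : ℂ) ^ ((N : ℤ) - n - 2 * n') *
            ((n' : ℂ) * ((Real.log N : ℝ) : ℂ) ^ (n' - 1) / (N : ℂ)))) ∧
      (0 < n' → ArcAsymptotics.iotaMin D = 1 →
        Asymptotics.IsEquivalent atTop
          (fun N : ℕ => ArcAsymptotics.taylorCoeff (ArcAsymptotics.breve n' D) N)
          (fun N : ℕ => (1 + (-1 : ℂ) ^ (n + N)) * φt (1 / 2) *
            (2 : ℂ) ^ ((N : ℤ) - n - 2 * n') *
            ((N : ℂ) ^ (ArcAsymptotics.muMax D - 1) /
              ((ArcAsymptotics.muMax D - 1).factorial : ℂ)) *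
            ((Real.log N : ℝ) : ℂ) ^ n')) := by
  refine ⟨fun α => ArcAsymptotics.differentiable_varphi n' (D α), fun z hz => ⟨fun α =>
    (ArcAsymptotics.hasSum_brevePS n' (D α) z hz).summable, ?_⟩,
    ArcAsymptotics.analyticOnNhd_breve n' hr hV,
    fun z _ => ArcAsymptotics.summable_phiTerm hV z, ArcAsymptotics.phiReg D,
    ArcAsymptotics.analyticAt_phiReg hr hV, ArcAsymptotics.phiReg_ne_zero hr hV,
    ArcAsymptotics.phi_eq_phiReg hr, ?_,
    fun hn' hι => ArcAsymptotics.isEquivalent_breve_of_one_lt hr hn' hV hι,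
    fun _ hι => ArcAsymptotics.isEquivalent_breve_of_eq_one hr hV hι⟩
  · simp only [ArcAsymptotics.breveTerm_eq n' _ hz]
    exact ((ArcAsymptotics.summable_phiTerm hV z).div_const _).mul_right _
  · rintro rfl
    exact ArcAsymptotics.isEquivalent_breve_zero hr hV
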